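/- All manifolds are smooth, finite-dimensional, Hausdorff and second countable; all vector bundles are smooth, real and of finite rank; sections and maps are smooth. A double vector bundle $(D;A,B;M)$ is a manifold $D$ with two vector bundle structures $\pi_A\colon D\to A$ and $\pi_B\colon D\to B$ over the total spaces of vector bundles $q_A\colon A\to M$, $q_B\colon B\to M$, such that $q_A\circ\pi_A=q_B\circ\pi_B$, and such that $\pi_B$, the addition and the scalar multiplication of $D\to B$ are vector bundle morphisms over $q_A$, the addition and the scalar multiplication of $A\to M$. Its core is $C=\{d\in D:\pi_A(d)=0,\ \pi_B(d)=0\}$, a vector bundle over $M$. A morphism of double vector bundles is a map $D_1\to D_2$ that is a vector bundle morphism for both structures, over vector bundle morphisms of the sides that lie over the same map $M_1\to M_2$. An involutive double vector bundle $(D;Q,Q;M)$, with projections $\pi_1,\pi_2\colon D\to Q$, is a double vector bundle with a map $\mathcal I\colon D\to D$, $\mathcal I^2=\mathrm{Id}$, that is a vector bundle morphism over $\mathrm{Id}_Q$ from $\pi_1$ to $\pi_2$ and from $\pi_2$ to $\pi_1$ and restricts to $-\mathrm{Id}$ on the core. A morphism of involutive double vector bundles $\Omega\colon D_1\to D_2$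 is a morphism of double vector bundles with $\Omega\circ\mathcal I_1=\mathcal I_2\circ\Omega$; it lies over a vector bundle morphism $\omega_Q\colon Q_1\to Q_2$ (the map induced through $\pi_1$) over a smooth map $\omega_0\colon M_1\to M_2$. For an involutive double vector bundle $D$, let $\mathbb E=D^*_{\pi_1}\to Q$ be the dual of $\pi_1\colon D\to Q$, and let $B$ be the dual of the core of $D$. Then $\mathbb E$ is a double vector bundle with sides $Q$ and $B$: an element $\Phi\in\mathbb E$ over $q\in Q_m$ projects to the form $c\mapsto\Phi(0_q+_2c)$ in $B_m$, and the addition over $B$ is given by $(\Phi_1+_B\Phi_2)(d_1+_2d_2)=\Phi_1(d_1)+\Phi_2(d_2)$. It has the linear metric $\langle e_1,e_2\rangle=e_1(d)+e_2(\mathcal I(d))$ for $e_1,e_2\in\mathbb E$ over the same point of $B$ and any $d\in D$ with $\pi_1(d)$, $\pi_2(d)$ the projections of $e_1$, $e_2$ to $Q$. A section of $\mathbb E\to Q$ is linear if it is a vector bundle morphism from $Q\to M$ to $\mathbb E\to B$ over a section of $B\to M$. Let $\mathcal C(\mathbb E)$ be the set of linear sections of $\mathbb E\to Q$ with isotropic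 image; it is a $C^\infty(M)$-module, $f$ acting by multiplication with $q_Q^*f$. For $\tau_1,\tau_2\in\Gamma(Q^*)$ let $\tau_1\wedge\tau_2=\frac12(\tau_1\otimes\tau_2-\tau_2\otimes\tau_1)$, and let $\widetilde{\tau_1\wedge\tau_2}\in\mathcal C(\mathbb E)$ be the section with $\langle\widetilde{\tau_1\wedge\tau_2},d\rangle=(\tau_1\wedge\tau_2)(\pi_1(d),\pi_2(d))$ for $d\in D$. **Theorem.** Let $(D_1;Q_1,Q_1;M_1)$ and $(D_2;Q_2,Q_2;M_2)$ be involutive double vector bundles, with duals $\mathbb E_1$ and $\mathbb E_2$ as above. A morphism $\Omega\colon D_1\to D_2$ of involutive double vector bundles is equivalent to a smooth map $\omega_0\colon M_1\to M_2$ with a pair of morphisms of modules over $\omega_0^*\colon C^\infty(M_2)\to C^\infty(M_1)$, $$\omega^\star\colon\mathcal C(\mathbb E_2)\to\mathcal C(\mathbb E_1),\qquad \omega_Q^\star\colon\Gamma(Q_2^*)\to\Gamma(Q_1^*),$$ such that $\omega^\star(\widetilde{\tau_1\wedge\tau_2})=\widetilde{\omega_Q^\star\tau_1\wedge\omega_Q^\star\tau_2}$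 for all $\tau_1,\tau_2\in\Gamma(Q_2^*)$. Precisely: each morphism $\Omega$, over $\omega_Q$ and $\omega_0$, induces exactly one such triple $(\omega_0,\omega^\star,\omega_Q^\star)$, where $\omega_0$ is the base map of $\Omega$ and $$\langle\omega^\star\chi,d\rangle=\langle\chi,\Omega(d)\rangle,\qquad \langle\omega_Q^\star\tau,q\rangle=\langle\tau,\omega_Q(q)\rangle$$ for all $\chi\in\mathcal C(\mathbb E_2)$, $d\in D_1$, $\tau\in\Gamma(Q_2^*)$, $q\in Q_1$; and each such triple is induced by exactly one morphism $\Omega$. -/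

import Mathlib

open Bundle Manifold ContDiff

universe u v
noncomputable section

/-- A smooth real vector bundle of finite rank over the manifold `M`: a bundled version of Mathlib's
smooth vector bundles, with model fibre `F` and fibres `Fib m`. -/
structure SmoothVB {E H : Type*} [NormedAddCommGroup E] [NormedSpace ℝ E] [TopologicalSpace H]
    (I : ModelWithCorners ℝ E H) (M : Type u) [TopologicalSpace M] [ChartedSpace H M] where
  F : Type
  [normedF : NormedAddCommGroup F]
  [spaceF : NormedSpace ℝ F]
  [finF : FiniteDimensional ℝ F]
  Fib : M → Type u
  [topTot : TopologicalSpace (TotalSpace F Fib)]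
  [topFib : ∀ x, TopologicalSpace (Fib x)]
  [addFib : ∀ x, AddCommGroup (Fib x)]
  [modFib : ∀ x, Module ℝ (Fib x)]
  [fiberBundle : FiberBundle F Fib]
  [vectorBundle : VectorBundle ℝ F Fib]
  [contMDiff : ContMDiffVectorBundle ∞ F Fib I]

namespace SmoothVB

attribute [instance] normedF spaceF finF topTot topFib addFib modFib fiberBundle vectorBundle
  contMDiff

variable {E H : Type*} [NormedAddCommGroup E] [NormedSpace ℝ E] [TopologicalSpace H]
  {I : ModelWithCorners ℝ E H} {M : Type u} [TopologicalSpace M] [ChartedSpace H M]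

/-- The total space, with the smooth manifold structure that Mathlib puts on it. -/
abbrev Tot (V : SmoothVB I M) : Type _ := TotalSpace V.F V.Fib

/-- The smooth (global) sections. -/
abbrev Sec (V : SmoothVB I M) : Type _ := Cₛ^∞⟮I; V.F, V.Fib⟯

/-- The dual vector bundle (Mathlib's smooth bundle of continuous linear maps to `ℝ`). -/
@[reducible] def dual (V : SmoothVB I M) : SmoothVB I M where
  F := V.F →L[ℝ] ℝ
  Fib := fun m => V.Fib m →L[ℝ] Trivial M ℝ m

/-- Fibrewise addition on the total space; only meaningful for elements of the same fibre. -/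
def tadd {V : SmoothVB I M} (x y : V.Tot) : V.Tot :=
  open Classical in
  if h : y.proj = x.proj then ⟨x.proj, x.2 + h ▸ y.2⟩ else x

/-- Fibrewise scalar multiplication on the total space. -/
def tsmul {V : SmoothVB I M} (t : ℝ) (x : V.Tot) : V.Tot := ⟨x.proj, t • x.2⟩

/-- The zero section. -/
def tzero (V : SmoothVB I M) (m : M) : V.Tot := ⟨m, 0⟩

@[simp] theorem tadd_mk {V : SmoothVB I M} (m : M) (u v : V.Fib m) :
    tadd (⟨m, u⟩ : V.Tot) ⟨m, v⟩ = ⟨m, u + v⟩ := by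
  simp [tadd]

/-- The fibrewise linear function `ℓ_s`, `x ↦ ⟨s (proj x), x⟩`, of a section `s` of the dual. -/
def linFun {V : SmoothVB I M} (s : V.dual.Sec) (x : V.Tot) : ℝ := s x.proj x.2

/-- A family of linear forms is a smooth section of the dual if its linear function is smooth. -/
theorem dual_contMDiff {V : SmoothVB I M} (s : ∀ m, V.dual.Fib m)
    (h : ContMDiff (I.prod 𝓘(ℝ, V.F)) 𝓘(ℝ, ℝ) ∞ (fun x : V.Tot => s x.proj x.2)) :
    ContMDiff I (I.prod 𝓘(ℝ, V.F →L[ℝ] ℝ)) ∞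
      (fun m => (⟨m, s m⟩ : V.dual.Tot)) := by
  intro m₀
  rw [contMDiffAt_totalSpace]
  refine ⟨contMDiffAt_id, ?_⟩
  let b := Module.finBasis ℝ V.F
  let e := trivializationAt V.F V.Fib m₀
  have key : ∀ m ∈ e.baseSet, (trivializationAt (V.F →L[ℝ] ℝ)
      (fun m => V.Fib m →L[ℝ] Trivial M ℝ m) m₀ ⟨m, s m⟩).2 =
      ∑ i, (s m (e.symm m (b i))) • LinearMap.toContinuousLinearMap (b.coord i) := by
    intro m hm
    rw [hom_trivializationAt_apply]
    ext v
    simp only [ContinuousLinearMap.inCoordinates]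
    have hv : v = ∑ i, b.repr v i • b i := (b.sum_repr v).symm
    have : ∀ w, e.symm m w = e.symmL ℝ m w := fun w => by rw [Trivialization.symmL_apply e hm]
    simp only [this, sum_apply, smul_apply]
    conv_lhs => rw [hv]
    simp only [map_sum, map_smul]
    simp [e, Trivial.continuousLinearMapAt_trivialization, mul_comm]
  have hsm : ContMDiffAt I 𝓘(ℝ, V.F →L[ℝ] ℝ) ∞
      (fun m => ∑ i, (s m (e.symm m (b i))) • LinearMap.toContinuousLinearMap (b.coord i)) m₀ := by
    refine ContMDiffAt.sum fun i _ => ?_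
    suffices hs : ContMDiffAt I 𝓘(ℝ, ℝ) ∞ (fun m => s m (e.symm m (b i))) m₀ from
      hs.smul contMDiffAt_const
    have hm₀ : m₀ ∈ e.baseSet := FiberBundle.mem_baseSet_trivializationAt' m₀
    have h1 := (e.contMDiffOn_symm (IB := I) (n := ∞))
    have h2 : ContMDiffAt I (I.prod 𝓘(ℝ, V.F)) ∞
        (fun m => e.toOpenPartialHomeomorph.symm (m, b i)) m₀ := by
      have h3 := h1.contMDiffAt (x := (m₀, b i))
        (e.open_target.mem_nhds (by rw [e.mem_target]; exact hm₀))
      exact h3.comp m₀ (contMDiffAt_id.prodMk contMDiffAt_const)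
    have h4 := (h _).comp m₀ h2
    refine h4.congr_of_eventuallyEq ?_
    filter_upwards [e.open_baseSet.mem_nhds hm₀] with m hm
    have : e.toOpenPartialHomeomorph.symm (m, b i) = ⟨m, e.symm m (b i)⟩ :=
      (e.mk_symm hm (b i)).symm
    exact congrArg (fun x : V.Tot => s x.proj x.2) this.symm
  refine hsm.congr_of_eventuallyEq ?_
  filter_upwards [e.open_baseSet.mem_nhds (FiberBundle.mem_baseSet_trivializationAt' m₀)] with m hm
  exact key m hm

/-- The section of the dual bundle defined by a smooth fibrewise linear function. -/
def secOfFun {V : SmoothVB I M} (g : V.Tot → ℝ)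
    (h : ContMDiff (I.prod 𝓘(ℝ, V.F)) 𝓘(ℝ, ℝ) ∞ g)
    (hadd : ∀ m (u v : V.Fib m), g ⟨m, u + v⟩ = g ⟨m, u⟩ + g ⟨m, v⟩)
    (hsmul : ∀ m (t : ℝ) (u : V.Fib m), g ⟨m, t • u⟩ = t * g ⟨m, u⟩) : V.dual.Sec where
  toFun m :=
    { toFun := fun u => g ⟨m, u⟩
      map_add' := hadd m
      map_smul' := hsmul m
      cont := h.continuous.comp (FiberBundle.continuous_totalSpaceMk V.F V.Fib m) }
  contMDiff_toFun := dual_contMDiff _ h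

theorem linFun_contMDiff {V : SmoothVB I M} (s : V.dual.Sec) :
    ContMDiff (I.prod 𝓘(ℝ, V.F)) 𝓘(ℝ, ℝ) ∞ (linFun s) := by
  have h1 : ContMDiff (I.prod 𝓘(ℝ, V.F)) (I.prod 𝓘(ℝ, V.F →L[ℝ] ℝ)) ∞
      (fun x : V.Tot => (⟨x.proj, s x.proj⟩ : V.dual.Tot)) :=
    s.contMDiff.comp (contMDiff_proj V.Fib)
  have h2 : ContMDiff (I.prod 𝓘(ℝ, V.F)) (I.prod 𝓘(ℝ, V.F)) ∞
      (fun x : V.Tot => TotalSpace.mk' V.F x.proj x.2) := contMDiff_id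
  have h3 := ContMDiff.clm_bundle_apply (E₂ := Trivial M ℝ) (F₂ := ℝ) h1 h2
  intro x
  exact (contMDiffAt_totalSpace.1 (h3 x)).2

/-- The value `⟨⟨Φ, x⟩⟩` of a point `Φ` of the dual bundle on a point `x` of the bundle;
only meaningful if both lie over the same base point. -/
def ev {V : SmoothVB I M} (Φ : V.dual.Tot) (x : V.Tot) : ℝ :=
  open Classical in
  if h : x.proj = Φ.proj then Φ.2 (h ▸ x.2) else 0

/-- The value of a section, as a point of the total space. -/
def pt {V : SmoothVB I M} (s : V.Sec) (m : M) : V.Tot := ⟨m, s m⟩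

theorem tsmul_mk {V : SmoothVB I M} (t : ℝ) (m : M) (u : V.Fib m) :
    tsmul t (⟨m, u⟩ : V.Tot) = ⟨m, t • u⟩ := rfl

theorem tsmul_tzero {V : SmoothVB I M} (t : ℝ) (m : M) : tsmul t (tzero V m) = tzero V m := by
  rw [tzero, tsmul_mk, smul_zero]

theorem tadd_tzero_tzero {V : SmoothVB I M} (m : M) :
    tadd (tzero V m) (tzero V m) = tzero V m := by
  rw [tzero, tadd_mk, add_zero]

theorem zero_tsmul {V : SmoothVB I M} (x : V.Tot) : tsmul 0 x = tzero V x.proj := by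
  rw [tsmul, zero_smul]
  rfl

theorem ev_mk {V : SmoothVB I M} (m : M) (φ : V.dual.Fib m) (x : V.Fib m) :
    ev (⟨m, φ⟩ : V.dual.Tot) ⟨m, x⟩ = φ x := by
  simp [ev]

theorem ev_pt {V : SmoothVB I M} (s : V.dual.Sec) (x : V.Tot) :
    ev (pt s x.proj) x = linFun s x :=
  ev_mk x.proj (s x.proj) x.2

theorem ev_tadd {V : SmoothVB I M} (Φ : V.dual.Tot) (x y : V.Tot) (hx : x.proj = Φ.proj)
    (hy : y.proj = Φ.proj) : ev Φ (tadd x y) = ev Φ x + ev Φ y := by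
  obtain ⟨m, φ⟩ := Φ
  obtain ⟨k, x⟩ := x
  obtain ⟨l, y⟩ := y
  obtain rfl : k = m := hx
  obtain rfl : l = k := hy
  rw [tadd_mk, ev_mk, ev_mk, ev_mk]
  exact φ.map_add x y

theorem ev_tsmul {V : SmoothVB I M} (Φ : V.dual.Tot) (t : ℝ) (x : V.Tot) (hx : x.proj = Φ.proj) :
    ev Φ (tsmul t x) = t * ev Φ x := by
  obtain ⟨m, φ⟩ := Φ
  obtain ⟨k, x⟩ := x
  obtain rfl : k = m := hx
  rw [tsmul, ev_mk, ev_mk]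
  exact φ.map_smul t x

/-- Sections form a module over the smooth functions on the base. -/
instance secModule {F : Type*} [NormedAddCommGroup F] [NormedSpace ℝ F] {V : M → Type*}
    [TopologicalSpace (TotalSpace F V)] [∀ x, TopologicalSpace (V x)] [FiberBundle F V]
    [∀ x, AddCommGroup (V x)] [∀ x, Module ℝ (V x)] [VectorBundle ℝ F V] :
    Module C^∞⟮I, M; ℝ⟯ Cₛ^∞⟮I; F, V⟯ where
  smul f s := ⟨fun m => f m • s m, f.contMDiff.smul_section s.contMDiff⟩
  one_smul s := by ext m; exact one_smul ℝ (s m)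
  mul_smul f g s := by ext m; exact mul_smul (f m) (g m) (s m)
  smul_zero f := by ext m; exact smul_zero (f m)
  smul_add f s t := by ext m; exact smul_add (f m) (s m) (t m)
  add_smul f g s := by ext m; exact add_smul (f m) (g m) (s m)
  zero_smul s := by ext m; exact zero_smul ℝ (s m)

theorem ev_pt_add {V : SmoothVB I M} (s t : V.dual.Sec) (m : M) (x : V.Tot) :
    ev (pt (s + t) m) x = ev (pt s m) x + ev (pt t m) x := by
  unfold ev pt
  split_ifs with h
  · rfl
  · simp

theorem ev_pt_zero {V : SmoothVB I M} (m : M) (x : V.Tot) :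
    ev (pt (0 : V.dual.Sec) m) x = 0 := by
  unfold ev pt
  split_ifs with h <;> rfl

theorem ev_pt_smul {V : SmoothVB I M} (f : C^∞⟮I, M; ℝ⟯) (s : V.dual.Sec) (m : M) (x : V.Tot) :
    ev (pt (f • s) m) x = f m * ev (pt s m) x := by
  unfold ev pt
  split_ifs with h
  · rfl
  · simp

theorem ev_pt_neg {V : SmoothVB I M} (s : V.dual.Sec) (m : M) (x : V.Tot) :
    ev (pt (-s) m) x = - ev (pt s m) x := by
  unfold ev pt
  split_ifs with h
  · rfl
  · simp

theorem tadd_proj {V : SmoothVB I M} (x y : V.Tot) : (tadd x y).proj = x.proj := by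
  unfold tadd
  split_ifs <;> rfl

theorem tadd_tzero {V : SmoothVB I M} (x : V.Tot) : tadd x (tzero V x.proj) = x := by
  obtain ⟨m, x⟩ := x
  simp [tzero]

theorem linFun_tadd {V : SmoothVB I M} (s : V.dual.Sec) (x y : V.Tot) (h : x.proj = y.proj) :
    linFun s (tadd x y) = linFun s x + linFun s y := by
  have := ev_tadd (pt s x.proj) x y rfl h.symm
  rw [ev_pt] at this
  rw [← ev_pt, tadd_proj, this, h, ev_pt]

theorem linFun_tsmul {V : SmoothVB I M} (s : V.dual.Sec) (t : ℝ) (x : V.Tot) :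
    linFun s (tsmul t x) = t * linFun s x :=
  (s x.proj).map_smul t x.2

theorem linFun_tzero {V : SmoothVB I M} (s : V.dual.Sec) (m : M) :
    linFun s (tzero V m) = 0 :=
  (s m).map_zero

end SmoothVB

/-- The ring morphism `φ^* : C^∞(N) → C^∞(M)` of a smooth map `φ : M → N`. -/
def pullbackFun {E H : Type*} [NormedAddCommGroup E] [NormedSpace ℝ E] [TopologicalSpace H]
    {I : ModelWithCorners ℝ E H} {M : Type u} [TopologicalSpace M] [ChartedSpace H M]
    {E' H' : Type*} [NormedAddCommGroup E'] [NormedSpace ℝ E'] [TopologicalSpace H']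
    {J : ModelWithCorners ℝ E' H'} {N : Type v} [TopologicalSpace N] [ChartedSpace H' N]
    (φ : C^∞⟮I, M; J, N⟯) : C^∞⟮J, N; ℝ⟯ →+* C^∞⟮I, M; ℝ⟯ where
  toFun f := f.comp φ
  map_one' := rfl
  map_mul' _ _ := rfl
  map_zero' := rfl
  map_add' _ _ := rfl

/-- `Ψ` is a morphism of smooth vector bundles over the smooth map `f`. -/
structure IsVBMorphism {E H : Type*} [NormedAddCommGroup E] [NormedSpace ℝ E] [TopologicalSpace H]
    {I : ModelWithCorners ℝ E H} {M : Type u} [TopologicalSpace M] [ChartedSpace H M]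
    {E' H' : Type*} [NormedAddCommGroup E'] [NormedSpace ℝ E'] [TopologicalSpace H']
    {J : ModelWithCorners ℝ E' H'} {N : Type v} [TopologicalSpace N] [ChartedSpace H' N]
    (V : SmoothVB I M) (W : SmoothVB J N) (Ψ : V.Tot → W.Tot) (f : M → N) : Prop where
  smooth : ContMDiff (I.prod 𝓘(ℝ, V.F)) (J.prod 𝓘(ℝ, W.F)) ∞ Ψ
  smooth_base : ContMDiff I J ∞ f
  proj : ∀ x, (Ψ x).proj = f x.proj
  map_add : ∀ x y : V.Tot, x.proj = y.proj →
    Ψ (SmoothVB.tadd x y) = SmoothVB.tadd (Ψ x) (Ψ y)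
  map_smul : ∀ (t : ℝ) (x : V.Tot), Ψ (SmoothVB.tsmul t x) = SmoothVB.tsmul t (Ψ x)

open SmoothVB

section
variable {n : ℕ} {M : Type u} [TopologicalSpace M] [ChartedSpace (EuclideanSpace ℝ (Fin n)) M]

/-- A smooth manifold `D` with two vector bundle structures, over the total spaces of the vector
bundles `A` and `B` on `M`. The manifold `D` is the total space of the first one, and is identified
with the total space of the second one by the diffeomorphism `ident`. -/
structure DoubleBundle (A B : SmoothVB (𝓡 n) M) where
  over₁ : SmoothVB ((𝓡 n).prod 𝓘(ℝ, A.F)) A.Tot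
  over₂ : SmoothVB ((𝓡 n).prod 𝓘(ℝ, B.F)) B.Tot
  ident : Diffeomorph (((𝓡 n).prod 𝓘(ℝ, A.F)).prod 𝓘(ℝ, over₁.F))
    (((𝓡 n).prod 𝓘(ℝ, B.F)).prod 𝓘(ℝ, over₂.F)) over₁.Tot over₂.Tot ∞

namespace DoubleBundle
variable {A B : SmoothVB (𝓡 n) M} (D : DoubleBundle A B)

/-- The manifold `D`. -/
abbrev Tot : Type _ := D.over₁.Tot
variable {D}
/-- The projection `D → A`. -/
def π₁ (d : D.Tot) : A.Tot := d.proj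
/-- The projection `D → B`. -/
def π₂ (d : D.Tot) : B.Tot := (D.ident d).proj
/-- The addition in the fibres of `D → A`. -/
def add₁ (x y : D.Tot) : D.Tot := tadd x y
/-- The scalar multiplication in the fibres of `D → A`. -/
def smul₁ (t : ℝ) (d : D.Tot) : D.Tot := tsmul t d
/-- The addition in the fibres of `D → B`. -/
def add₂ (x y : D.Tot) : D.Tot := D.ident.symm (tadd (D.ident x) (D.ident y))
/-- The scalar multiplication in the fibres of `D → B`. -/
def smul₂ (t : ℝ) (d : D.Tot) : D.Tot := D.ident.symm (tsmul t (D.ident d))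
variable (D)
/-- The zero section of `D → A`. -/
def zero₁ (a : A.Tot) : D.Tot := tzero D.over₁ a
end DoubleBundle

open DoubleBundle

/-- A double vector bundle `(D; A, B; M)`: the square of projections commutes, `D → B` is a vector
bundle morphism over `A → M` (`proj₂`), the addition of `D → B` is a vector bundle morphism over the
addition of `A` (`π₁_add₂`, `interchange`, `add₂_smul₁`), and the scalar multiplication of `D → B` is
a vector bundle morphism over that of `A` (`π₁_smul₂`, `smul₂_add₁`, `smul₂_smul₁`). -/
structure DoubleVectorBundle (A B : SmoothVB (𝓡 n) M) extends DoubleBundle A B where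
  square : ∀ d : toDoubleBundle.Tot, (π₁ d).proj = (π₂ d).proj
  proj₂ : IsVBMorphism over₁ B (π₂ (D := toDoubleBundle)) TotalSpace.proj
  π₁_add₂ : ∀ d d' : toDoubleBundle.Tot, π₂ d = π₂ d' →
    π₁ (add₂ d d') = tadd (π₁ d) (π₁ d')
  interchange : ∀ d₁ d₂ d₃ d₄ : toDoubleBundle.Tot, π₁ d₁ = π₁ d₂ → π₁ d₃ = π₁ d₄ →
    π₂ d₁ = π₂ d₃ → π₂ d₂ = π₂ d₄ →
    add₂ (add₁ d₁ d₂) (add₁ d₃ d₄) = add₁ (add₂ d₁ d₃) (add₂ d₂ d₄)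
  add₂_smul₁ : ∀ (t : ℝ) (d d' : toDoubleBundle.Tot), π₂ d = π₂ d' →
    add₂ (smul₁ t d) (smul₁ t d') = smul₁ t (add₂ d d')
  π₁_smul₂ : ∀ (t : ℝ) (d : toDoubleBundle.Tot), π₁ (smul₂ t d) = tsmul t (π₁ d)
  smul₂_add₁ : ∀ (t : ℝ) (d d' : toDoubleBundle.Tot), π₁ d = π₁ d' →
    smul₂ t (add₁ d d') = add₁ (smul₂ t d) (smul₂ t d')
  smul₂_smul₁ : ∀ (t s : ℝ) (d : toDoubleBundle.Tot),
    smul₂ t (smul₁ s d) = smul₁ s (smul₂ t d)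

namespace DoubleVectorBundle
variable {A B : SmoothVB (𝓡 n) M} (D : DoubleVectorBundle A B)

theorem π₂_zero₁ (a : A.Tot) : π₂ (D.zero₁ a) = tzero B a.proj := by
  have h := D.proj₂.map_smul 0 (D.zero₁ a)
  have hp : (π₂ (D.zero₁ a)).proj = a.proj := D.proj₂.proj _
  rw [zero_tsmul, zero_tsmul, hp] at h
  exact h

theorem π₂_add₁ (d d' : D.Tot) (h : π₁ d = π₁ d') :
    π₂ (add₁ d d') = tadd (π₂ d) (π₂ d') := D.proj₂.map_add d d' h

theorem π₂_add₂ (d d' : D.Tot) : π₂ (add₂ d d') = π₂ d := by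
  simp [π₂, add₂, tadd_proj]

theorem π₂_smul₂ (t : ℝ) (d : D.Tot) : π₂ (smul₂ t d) = π₂ d := by
  simp [π₂, smul₂, tsmul]

/-- The fibre over `m` of the core: the elements of `D` over `0 ∈ A_m` and over `0 ∈ B_m`. -/
def coreFib (m : M) : Submodule ℝ (D.over₁.Fib (tzero A m)) where
  carrier := {x | π₂ (⟨tzero A m, x⟩ : D.Tot) = tzero B m}
  add_mem' {x y} hx hy := by
    have h := D.π₂_add₁ (⟨tzero A m, x⟩ : D.Tot) ⟨tzero A m, y⟩ rfl
    have hx' : π₂ (⟨tzero A m, x⟩ : D.Tot) = tzero B m := hx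
    have hy' : π₂ (⟨tzero A m, y⟩ : D.Tot) = tzero B m := hy
    rw [hx', hy', tadd_tzero_tzero, add₁, tadd_mk] at h
    exact h
  zero_mem' := D.π₂_zero₁ (tzero A m)
  smul_mem' t x hx := by
    have h := D.proj₂.map_smul t (⟨tzero A m, x⟩ : D.Tot)
    have hx' : π₂ (⟨tzero A m, x⟩ : D.Tot) = tzero B m := hx
    rw [hx', tsmul_tzero, tsmul_mk] at h
    exact h

/-- The inclusion of the core in `D`. -/
def coreIncl {m : M} (c : D.coreFib m) : D.Tot := ⟨tzero A m, c.1⟩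

/-- The element `0^D_a +_B c` of `D`, for `a ∈ A_m` and `c` in the core over `m`. -/
def addCore (a : A.Tot) (c : D.coreFib a.proj) : D.Tot := add₂ (D.zero₁ a) (D.coreIncl c)

theorem π₂_zero_core (a : A.Tot) (c : D.coreFib a.proj) :
    π₂ (D.zero₁ a) = π₂ (D.coreIncl c) :=
  (D.π₂_zero₁ a).trans c.2.symm

theorem π₁_addCore (a : A.Tot) (c : D.coreFib a.proj) : π₁ (D.addCore a c) = a :=
  (D.π₁_add₂ _ _ (D.π₂_zero_core a c)).trans (tadd_tzero a)

theorem addCore_add (a : A.Tot) (c c' : D.coreFib a.proj) :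
    D.addCore a (c + c') = add₁ (D.addCore a c) (D.addCore a c') := by
  have h := D.interchange (D.zero₁ a) (D.zero₁ a) (D.coreIncl c) (D.coreIncl c')
    rfl rfl (D.π₂_zero_core _ c) (D.π₂_zero_core _ c')
  have h1 : add₁ (D.zero₁ a) (D.zero₁ a) = D.zero₁ a := tadd_tzero_tzero a
  have h2 : add₁ (D.coreIncl c) (D.coreIncl c') = D.coreIncl (c + c') := tadd_mk _ _ _
  rw [h1, h2] at h
  exact h

theorem addCore_smul (a : A.Tot) (t : ℝ) (c : D.coreFib a.proj) :
    D.addCore a (t • c) = smul₁ t (D.addCore a c) := by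
  have h := D.add₂_smul₁ t _ _ (D.π₂_zero_core a c)
  have h1 : smul₁ t (D.zero₁ a) = D.zero₁ a := tsmul_tzero t a
  have h2 : smul₁ t (D.coreIncl c) = D.coreIncl (t • c) := rfl
  rw [h1, h2] at h
  exact h

/-- The second projection of the dual double vector bundle `D^*_A`, which has sides `A` and the
dual of the core: `Φ ∈ D^*_A` over `a ∈ A_m` is sent to `c ↦ Φ (0^D_a +_B c)`. -/
def dualProj (Φ : D.over₁.dual.Tot) : Module.Dual ℝ (D.coreFib Φ.proj.proj) where
  toFun c := ev Φ (D.addCore Φ.proj c)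
  map_add' c c' := by
    rw [D.addCore_add]
    exact ev_tadd Φ _ _ (D.π₁_addCore _ c) (D.π₁_addCore _ c')
  map_smul' t c := by
    rw [D.addCore_smul]
    exact ev_tsmul Φ t _ (D.π₁_addCore _ c)

/-- `Φ = Φ₁ +_{C^*} Φ₂`, the addition of elements of `D^*_A` with the same projection to the dual of
the core: `Φ` lies over `a₁ + a₂` and `Φ (d₁ +_B d₂) = Φ₁ d₁ + Φ₂ d₂`. -/
def IsDualAdd (Φ₁ Φ₂ Φ : D.over₁.dual.Tot) : Prop :=
  Φ.proj = tadd Φ₁.proj Φ₂.proj ∧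
    ∀ d₁ d₂ : D.Tot, π₁ d₁ = Φ₁.proj → π₁ d₂ = Φ₂.proj → π₂ d₁ = π₂ d₂ →
      ev Φ (add₂ d₁ d₂) = ev Φ₁ d₁ + ev Φ₂ d₂

/-- `Ψ = t ·_{C^*} Φ`, for elements of `D^*_A` with the same projection to the dual of the core:
`Ψ` lies over `t a` and `Ψ (t ·_B d) = t Φ d`. -/
def IsDualSMul (t : ℝ) (Φ Ψ : D.over₁.dual.Tot) : Prop :=
  Ψ.proj = tsmul t Φ.proj ∧
    ∀ d : D.Tot, π₁ d = Φ.proj → ev Ψ (smul₂ t d) = t * ev Φ d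

/-- The smooth section `χ` of `D^*_A → A` is linear: it is a morphism of vector bundles from `A → M`
to `D^*_A → C^*` over a section `b` of the dual `C^*` of the core `C`. (The section `b` inherits
smoothness from `χ`.) -/
structure IsLinearSection (χ : D.over₁.dual.Sec) : Prop where
  proj : ∃ b : ∀ m, Module.Dual ℝ (D.coreFib m), ∀ a : A.Tot, D.dualProj (pt χ a) = b a.proj
  add : ∀ a a' : A.Tot, a.proj = a'.proj → D.IsDualAdd (pt χ a) (pt χ a') (pt χ (tadd a a'))
  smul : ∀ (t : ℝ) (a : A.Tot), D.IsDualSMul t (pt χ a) (pt χ (tsmul t a))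

end DoubleVectorBundle

/-- An involutive double vector bundle `(D; Q, Q; M)`: the involution is a morphism of double vector
bundles that exchanges the two structures of `D`, is the identity on the sides and minus the identity
on the core. -/
structure InvolutiveDVB (Q : SmoothVB (𝓡 n) M) extends DoubleVectorBundle Q Q where
  inv : toDoubleVectorBundle.Tot → toDoubleVectorBundle.Tot
  inv₁₂ : IsVBMorphism over₁ over₂ (fun d => ident (inv d)) id
  inv₂₁ : IsVBMorphism over₂ over₁ (fun d => inv (ident.symm d)) id
  inv_inv : ∀ d, inv (inv d) = d
  inv_core : ∀ (m : M) (c : toDoubleVectorBundle.coreFib m),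
    inv (toDoubleVectorBundle.coreIncl c) = toDoubleVectorBundle.coreIncl (-c)

namespace InvolutiveDVB
variable {Q : SmoothVB (𝓡 n) M} (D : InvolutiveDVB Q)

theorem π₂_inv (d : D.Tot) : π₂ (D.inv d) = π₁ d := D.inv₁₂.proj d

theorem π₁_inv (d : D.Tot) : π₁ (D.inv d) = π₂ d := by
  have h := D.inv₂₁.proj (D.ident d)
  rwa [D.ident.symm_apply_apply] at h

/-- The dual `𝔼 = D^*_{π₁}`, a vector bundle over `Q`. -/
abbrev dualE : SmoothVB ((𝓡 n).prod 𝓘(ℝ, Q.F)) Q.Tot := D.over₁.dual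

/-- `⟨e₁, e₂⟩ = r` for the linear metric of `𝔼 → B`, `B` the dual of the core of `D`: for
`e₁, e₂ ∈ 𝔼` with the same projection to `B`, the metric is `⟨e₁, e₂⟩ = e₁ d + e₂ (inv d)` for any
`d ∈ D` with `π₁ d` and `π₂ d` the projections to `Q` of `e₁` and `e₂`. -/
def HasMetricValue (e₁ e₂ : D.dualE.Tot) (r : ℝ) : Prop :=
  ∀ d : D.Tot, π₁ d = e₁.proj → π₂ d = e₂.proj → ev e₁ d + ev e₂ (D.inv d) = r

/-- The section `χ` of `𝔼 → Q` has isotropic image. -/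
def IsIsotropic (χ : D.dualE.Sec) : Prop :=
  ∀ q q' : Q.Tot, q.proj = q'.proj → D.HasMetricValue (pt χ q) (pt χ q') 0

/-- `𝒞(𝔼)`: the linear sections of `𝔼 → Q` with isotropic image. -/
def isotropicSections : AddSubgroup D.dualE.Sec where
  carrier := {χ | D.IsLinearSection χ ∧ D.IsIsotropic χ}
  add_mem' := by
    rintro χ χ' ⟨⟨⟨b, hb⟩, ha, hs⟩, hi⟩ ⟨⟨⟨b', hb'⟩, ha', hs'⟩, hi'⟩
    refine ⟨⟨⟨fun m => b m + b' m, fun a => ?_⟩, fun a a' h => ⟨rfl, fun d₁ d₂ h₁ h₂ h₃ => ?_⟩,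
      fun t a => ⟨rfl, fun d h => ?_⟩⟩, fun q q' h d h₁ h₂ => ?_⟩
    · ext c
      have e1 := LinearMap.congr_fun (hb a) c
      have e2 := LinearMap.congr_fun (hb' a) c
      exact (ev_pt_add χ χ' a _).trans (congrArg₂ (· + ·) e1 e2)
    · rw [ev_pt_add, ev_pt_add, ev_pt_add, (ha a a' h).2 d₁ d₂ h₁ h₂ h₃,
        (ha' a a' h).2 d₁ d₂ h₁ h₂ h₃]
      ring
    · rw [ev_pt_add, ev_pt_add, (hs t a).2 d h, (hs' t a).2 d h]
      ring
    · rw [ev_pt_add, ev_pt_add]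
      linarith [hi q q' h d h₁ h₂, hi' q q' h d h₁ h₂]
  zero_mem' := by
    refine ⟨⟨⟨fun m => 0, fun a => ?_⟩, fun a a' h => ⟨rfl, fun d₁ d₂ h₁ h₂ h₃ => ?_⟩,
      fun t a => ⟨rfl, fun d h => ?_⟩⟩, fun q q' h d h₁ h₂ => ?_⟩
    · ext c
      exact ev_pt_zero (V := D.over₁) a _
    · simp only [ev_pt_zero, add_zero]
    · simp only [ev_pt_zero, mul_zero]
    · simp only [ev_pt_zero, add_zero]
  neg_mem' := by
    rintro χ ⟨⟨⟨b, hb⟩, ha, hs⟩, hi⟩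
    refine ⟨⟨⟨fun m => -b m, fun a => ?_⟩, fun a a' h => ⟨rfl, fun d₁ d₂ h₁ h₂ h₃ => ?_⟩,
      fun t a => ⟨rfl, fun d h => ?_⟩⟩, fun q q' h d h₁ h₂ => ?_⟩
    · ext c
      have e1 := LinearMap.congr_fun (hb a) c
      exact (ev_pt_neg χ a _).trans (congrArg Neg.neg e1)
    · rw [ev_pt_neg, ev_pt_neg, ev_pt_neg, (ha a a' h).2 d₁ d₂ h₁ h₂ h₃]
      ring
    · rw [ev_pt_neg, ev_pt_neg, (hs t a).2 d h]
      ring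
    · rw [ev_pt_neg, ev_pt_neg]
      linarith [hi q q' h d h₁ h₂]

/-- The pullback `q_Q^* f` to `Q` of a smooth function `f` on `M`. -/
def pullQ (f : C^∞⟮𝓡 n, M; ℝ⟯) : C^∞⟮(𝓡 n).prod 𝓘(ℝ, Q.F), Q.Tot; ℝ⟯ :=
  f.comp ⟨TotalSpace.proj, contMDiff_proj Q.Fib⟩

theorem pullQ_smul_mem (f : C^∞⟮𝓡 n, M; ℝ⟯) {χ : D.dualE.Sec} (h : χ ∈ D.isotropicSections) :
    pullQ (Q := Q) f • χ ∈ D.isotropicSections := by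
  obtain ⟨⟨⟨b, hb⟩, ha, hs⟩, hi⟩ := h
  have hf : ∀ q : Q.Tot, pullQ (Q := Q) f q = f q.proj := fun _ => rfl
  refine ⟨⟨⟨fun m => f m • b m, fun a => ?_⟩, fun a a' h => ⟨rfl, fun d₁ d₂ h₁ h₂ h₃ => ?_⟩,
    fun t a => ⟨rfl, fun d h => ?_⟩⟩, fun q q' h d h₁ h₂ => ?_⟩
  · ext c
    have e1 := LinearMap.congr_fun (hb a) c
    exact (ev_pt_smul _ χ a _).trans (congrArg (fun r => f a.proj * r) e1)
  · rw [ev_pt_smul, ev_pt_smul, ev_pt_smul, (ha a a' h).2 d₁ d₂ h₁ h₂ h₃, hf, hf, hf, tadd_proj, h]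
    ring
  · rw [ev_pt_smul, ev_pt_smul, (hs t a).2 d h, hf, hf, tsmul]
    ring
  · rw [ev_pt_smul, ev_pt_smul, hf, hf, h, ← mul_add, hi q q' h d h₁ h₂, mul_zero]

/-- `𝒞(𝔼)` is a `C^∞(M)`-module, `f` acting by multiplication with `q_Q^* f`. -/
instance : Module C^∞⟮𝓡 n, M; ℝ⟯ D.isotropicSections where
  smul f χ := ⟨pullQ (Q := Q) f • χ.1, D.pullQ_smul_mem f χ.2⟩
  one_smul χ := Subtype.ext (one_smul _ χ.1)
  mul_smul f g χ := Subtype.ext (mul_smul (pullQ (Q := Q) f) (pullQ (Q := Q) g) χ.1)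
  smul_zero f := Subtype.ext (smul_zero (pullQ (Q := Q) f))
  smul_add f χ χ' := Subtype.ext (smul_add (pullQ (Q := Q) f) χ.1 χ'.1)
  add_smul f g χ := Subtype.ext (add_smul (pullQ (Q := Q) f) (pullQ (Q := Q) g) χ.1)
  zero_smul χ :=
    Subtype.ext (zero_smul C^∞⟮(𝓡 n).prod 𝓘(ℝ, Q.F), Q.Tot; ℝ⟯ χ.1)

/-- The value of the two-form `τ₁ ∧ τ₂ = ½ (τ₁ ⊗ τ₂ - τ₂ ⊗ τ₁)` on `(q, q')`. -/
def wedgeForm (τ₁ τ₂ : Q.dual.Sec) (q q' : Q.Tot) : ℝ :=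
  (1 / 2 : ℝ) * (linFun τ₁ q * linFun τ₂ q' - linFun τ₂ q * linFun τ₁ q')

/-- The core-linear section of `𝔼 → Q` defined by `τ₁ ∧ τ₂`. The core of `𝔼` is the dual of `Q`, with
`τ ∈ Q^*_m` acting on `d ∈ D` over `0 ∈ Q_m` by `⟨τ, π₂ d⟩`. Hence the core-linear section
`q ↦ 0^𝔼_q +_B φ(q)` of a bilinear form `φ` has the value `φ (π₁ d, π₂ d)` on `d`. -/
def wedgeSec (τ₁ τ₂ : Q.dual.Sec) : D.dualE.Sec :=
  secOfFun (fun d : D.Tot => wedgeForm τ₁ τ₂ (π₁ d) (π₂ d))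
    (by
      have hp : ContMDiff (((𝓡 n).prod 𝓘(ℝ, Q.F)).prod 𝓘(ℝ, D.over₁.F))
          ((𝓡 n).prod 𝓘(ℝ, Q.F)) ∞ (fun d : D.Tot => π₁ d) := contMDiff_proj D.over₁.Fib
      have hq := D.proj₂.smooth
      have h1 := (linFun_contMDiff τ₁).comp hp
      have h2 := (linFun_contMDiff τ₂).comp hp
      have h3 := (linFun_contMDiff τ₁).comp hq
      have h4 := (linFun_contMDiff τ₂).comp hq
      exact contMDiff_const.mul ((h1.mul h4).sub (h2.mul h3)))
    (by
      intro q u v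
      have h := D.π₂_add₁ (⟨q, u⟩ : D.Tot) ⟨q, v⟩ rfl
      have hp : (π₂ (⟨q, u⟩ : D.Tot)).proj = (π₂ (⟨q, v⟩ : D.Tot)).proj :=
        (D.proj₂.proj (⟨q, u⟩ : D.Tot)).trans (D.proj₂.proj (⟨q, v⟩ : D.Tot)).symm
      rw [add₁, tadd_mk] at h
      simp only [wedgeForm, h, linFun_tadd _ _ _ hp, π₁]
      ring)
    (by
      intro q t u
      have h : π₂ (⟨q, t • u⟩ : D.Tot) = tsmul t (π₂ (⟨q, u⟩ : D.Tot)) :=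
        D.proj₂.map_smul t (⟨q, u⟩ : D.Tot)
      simp only [wedgeForm, h, linFun_tsmul, π₁]
      ring)

theorem linFun_wedgeSec (τ₁ τ₂ : Q.dual.Sec) (d : D.Tot) :
    linFun (D.wedgeSec τ₁ τ₂) d = wedgeForm τ₁ τ₂ (π₁ d) (π₂ d) := rfl

theorem ev_wedgeSec (τ₁ τ₂ : Q.dual.Sec) (q : Q.Tot) (d : D.Tot) (h : π₁ d = q) :
    ev (pt (D.wedgeSec τ₁ τ₂) q) d = wedgeForm τ₁ τ₂ q (π₂ d) := by
  subst h
  exact (ev_pt (D.wedgeSec τ₁ τ₂) d).trans (D.linFun_wedgeSec τ₁ τ₂ d)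

theorem wedgeSec_mem (τ₁ τ₂ : Q.dual.Sec) : D.wedgeSec τ₁ τ₂ ∈ D.isotropicSections := by
  refine ⟨⟨⟨fun m => 0, fun a => ?_⟩, fun a a' h => ⟨rfl, fun d₁ d₂ h₁ h₂ h₃ => ?_⟩,
    fun t a => ⟨rfl, fun d h => ?_⟩⟩, fun q q' h d h₁ h₂ => ?_⟩
  · ext c
    refine (D.ev_wedgeSec τ₁ τ₂ a _ (D.π₁_addCore a c)).trans ?_
    have h : π₂ (D.addCore a c) = tzero Q a.proj := (D.π₂_add₂ _ _).trans (D.π₂_zero₁ a)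
    simp only [h, wedgeForm, linFun_tzero, mul_zero, sub_zero]
    rfl
  · have h₁' : π₁ d₁ = a := h₁
    have h₂' : π₁ d₂ = a' := h₂
    have h4 : π₁ (add₂ d₁ d₂) = tadd a a' := by rw [D.π₁_add₂ _ _ h₃, h₁', h₂']
    rw [D.ev_wedgeSec _ _ _ _ h4, D.ev_wedgeSec _ _ _ _ h₁', D.ev_wedgeSec _ _ _ _ h₂',
      D.π₂_add₂, ← h₃]
    simp only [wedgeForm, linFun_tadd _ _ _ h]
    ring
  · have h' : π₁ d = a := h
    have h4 : π₁ (smul₂ t d) = tsmul t a := by rw [D.π₁_smul₂, h']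
    rw [D.ev_wedgeSec _ _ _ _ h4, D.ev_wedgeSec _ _ _ _ h', D.π₂_smul₂]
    simp only [wedgeForm, linFun_tsmul]
    ring
  · have h₁' : π₁ d = q := h₁
    have h₂' : π₂ d = q' := h₂
    have h5 : π₁ (D.inv d) = q' := by rw [D.π₁_inv, h₂']
    rw [D.ev_wedgeSec _ _ _ _ h₁', D.ev_wedgeSec _ _ _ _ h5, D.π₂_inv, h₁', h₂']
    simp only [wedgeForm]
    ring

/-- The core-linear section of `τ₁ ∧ τ₂`, as an element of `𝒞(𝔼)`. -/
def wedge (τ₁ τ₂ : Q.dual.Sec) : D.isotropicSections := ⟨D.wedgeSec τ₁ τ₂, D.wedgeSec_mem τ₁ τ₂⟩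

end InvolutiveDVB
end

section
variable {n₁ n₂ : ℕ}
  {M₁ : Type u} [TopologicalSpace M₁] [ChartedSpace (EuclideanSpace ℝ (Fin n₁)) M₁]
  {M₂ : Type v} [TopologicalSpace M₂] [ChartedSpace (EuclideanSpace ℝ (Fin n₂)) M₂]

/-- A morphism of double vector bundles `(D₁; A₁, B₁; M₁) → (D₂; A₂, B₂; M₂)`. -/
structure DVBHom {A₁ B₁ : SmoothVB (𝓡 n₁) M₁} {A₂ B₂ : SmoothVB (𝓡 n₂) M₂}
    (D₁ : DoubleVectorBundle A₁ B₁) (D₂ : DoubleVectorBundle A₂ B₂) where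
  toFun : D₁.Tot → D₂.Tot
  sideA : A₁.Tot → A₂.Tot
  sideB : B₁.Tot → B₂.Tot
  base : M₁ → M₂
  over₁ : IsVBMorphism D₁.over₁ D₂.over₁ toFun sideA
  over₂ : IsVBMorphism D₁.over₂ D₂.over₂ (fun d => D₂.ident (toFun (D₁.ident.symm d))) sideB
  overA : IsVBMorphism A₁ A₂ sideA base
  overB : IsVBMorphism B₁ B₂ sideB base

/-- A morphism of involutive double vector bundles. -/
structure IDVBHom {Q₁ : SmoothVB (𝓡 n₁) M₁} {Q₂ : SmoothVB (𝓡 n₂) M₂}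
    (D₁ : InvolutiveDVB Q₁) (D₂ : InvolutiveDVB Q₂) extends
    DVBHom D₁.toDoubleVectorBundle D₂.toDoubleVectorBundle where
  comm_inv : ∀ d, toFun (D₁.inv d) = D₂.inv (toFun d)

/-- A smooth map `ω₀ : M₁ → M₂` with morphisms of modules over `ω₀^* : C^∞(M₂) → C^∞(M₁)`,
`ω^⋆ : 𝒞(𝔼₂) → 𝒞(𝔼₁)` and `ω_Q^⋆ : Γ(Q₂^*) → Γ(Q₁^*)`, that are compatible with the wedge product. -/
structure ModuleMorphismPair {Q₁ : SmoothVB (𝓡 n₁) M₁} {Q₂ : SmoothVB (𝓡 n₂) M₂}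
    (D₁ : InvolutiveDVB Q₁) (D₂ : InvolutiveDVB Q₂) where
  base : C^∞⟮𝓡 n₁, M₁; 𝓡 n₂, M₂⟯
  mapC : D₂.isotropicSections →ₛₗ[pullbackFun base] D₁.isotropicSections
  mapQ : Q₂.dual.Sec →ₛₗ[pullbackFun base] Q₁.dual.Sec
  map_wedge : ∀ τ₁ τ₂ : Q₂.dual.Sec,
    mapC (D₂.wedge τ₁ τ₂) = D₁.wedge (mapQ τ₁) (mapQ τ₂)

/-- The pair `T` is the one that the morphism `Ω` induces on sections of the duals: `T` and `Ω` have
the same base map `ω₀`, the map `ω^⋆` is the restriction of the dual `Ω^⋆` of `Ω : D₁ → D₂` over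
`ω_Q`, i.e. `⟨ω^⋆ χ, d⟩ = ⟨χ, Ω d⟩`, and `ω_Q^⋆` is the dual of `ω_Q : Q₁ → Q₂` over `ω₀`, i.e.
`⟨ω_Q^⋆ τ, q⟩ = ⟨τ, ω_Q q⟩`. -/
structure IDVBHom.Induces {Q₁ : SmoothVB (𝓡 n₁) M₁} {Q₂ : SmoothVB (𝓡 n₂) M₂}
    {D₁ : InvolutiveDVB Q₁} {D₂ : InvolutiveDVB Q₂} (Ω : IDVBHom D₁ D₂)
    (T : ModuleMorphismPair D₁ D₂) : Prop where
  base : ∀ m, T.base m = Ω.base m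
  mapC : ∀ (χ : D₂.isotropicSections) (d : D₁.Tot),
    linFun (T.mapC χ).1 d = linFun χ.1 (Ω.toFun d)
  mapQ : ∀ (τ : Q₂.dual.Sec) (q : Q₁.Tot), linFun (T.mapQ τ) q = linFun τ (Ω.sideA q)
end

end

/-! Paired with points of `D`, the elements of `𝒞(𝔼)` are exactly the smooth functions on `D` that
are linear for both structures and change sign under the involution (`isBilinear_linFun`,
`linFun_inv`, `mem_isotropicSections`). A morphism `Ω` pulls such functions back to such functions,
which gives the direction from morphisms to pairs.

For the converse, `D` has to be recovered from these functions. A point of `D` is determined by its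
two projections and the values on it of `𝒞(𝔼)` (`eq_of_linFun_isotropic_eq`): two points with the
same projections differ by a core element, and core elements are separated by sections of the dual
of `D → Q`. Such a section becomes doubly linear when it is differentiated along the second scalar
multiplication, and skew when it is antisymmetrised; neither operation changes its values on the
core.

Existence of points is `exists_point_eq_linFun`: an additive functional `Λ` on `𝒞(𝔼)`, semilinear
over evaluation at `m`, with the values of `τ₁ ∧ τ₂` at `(a, b)` on wedges, is evaluation at a point
over `(a, b)`. Some point lies over `(a, b)` by `exists_over`; after subtraction of its evaluation,
`Λ` vanishes on wedges. An expansion `ρ²χ = ∑ (hᵢ ξᵢ + wedge)` with `hᵢ(m) = χ(vᵢ)`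
(`exists_isotropic_generators`) then turns `Λ` into evaluation at a core element.

For a pair, `ω_Q(q)` represents `τ ↦ (ω_Q^⋆ τ)(q)`, and `Ω(d)` represents `χ ↦ (ω^⋆ χ)(d)` over
`(ω_Q(π₁ d), ω_Q(π₂ d))`; the wedge condition is precisely what makes this possible. The algebraic
properties of `Ω` are tested on projections and on `𝒞(𝔼)`, its smoothness by
`contMDiffAt_of_linFun`. No local splitting of `D` is used. -/

noncomputable section
open SmoothVB DoubleBundle

/-! ### Vector bundles: homogeneous functions, dual frames, a smoothness criterion -/

namespace SmoothVB

open Topology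

variable {E H : Type*} [NormedAddCommGroup E] [NormedSpace ℝ E] [TopologicalSpace H]
  {I : ModelWithCorners ℝ E H} {M : Type u} [TopologicalSpace M] [ChartedSpace H M]

/-- Needed because `D → A` is a bundle over the manifold `A.Tot`: bump functions there require that
space to be Hausdorff. -/
theorem t2Space_tot [T2Space M] (V : SmoothVB I M) : T2Space V.Tot := by
  refine ⟨fun x y hxy => ?_⟩
  by_cases h : x.proj = y.proj
  · let e := trivializationAt V.F V.Fib x.proj
    have hx : x ∈ e.source := FiberBundle.mem_trivializationAt_proj_source
    have hy : y ∈ e.source := by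
      rw [e.mem_source, ← h]; exact FiberBundle.mem_baseSet_trivializationAt' _
    have hne : e x ≠ e y := fun h' => hxy (e.injOn hx hy h')
    obtain ⟨u, v, hu, hv, hxu, hyv, huv⟩ := t2_separation hne
    exact ⟨_, _, e.toOpenPartialHomeomorph.isOpen_inter_preimage hu,
      e.toOpenPartialHomeomorph.isOpen_inter_preimage hv, ⟨hx, hxu⟩, ⟨hy, hyv⟩,
      (huv.preimage e).mono Set.inter_subset_right Set.inter_subset_right⟩
  · exact separated_by_continuous (FiberBundle.continuous_proj V.F V.Fib) h

/-- Scalar multiplication is jointly smooth. -/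
theorem contMDiff_tsmul (V : SmoothVB I M) :
    ContMDiff (𝓘(ℝ, ℝ).prod (I.prod 𝓘(ℝ, V.F))) (I.prod 𝓘(ℝ, V.F)) ∞
      (fun p : ℝ × V.Tot => tsmul p.1 p.2) := by
  intro p₀
  rw [contMDiffAt_totalSpace]
  refine ⟨((contMDiff_proj V.Fib).comp contMDiff_snd).contMDiffAt, ?_⟩
  let e := trivializationAt V.F V.Fib p₀.2.proj
  have h1 : ContMDiffAt (𝓘(ℝ, ℝ).prod (I.prod 𝓘(ℝ, V.F))) 𝓘(ℝ, V.F) ∞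
      (fun p : ℝ × V.Tot => p.1 • (e p.2).2) p₀ := by
    refine contMDiffAt_fst.smul ?_
    have := (contMDiffAt_totalSpace.1 (contMDiffAt_id (x := p₀.2) (n := ∞)
      (I := I.prod 𝓘(ℝ, V.F)))).2
    exact this.comp p₀ contMDiffAt_snd
  refine h1.congr_of_eventuallyEq ?_
  have hcont : Continuous (fun p : ℝ × V.Tot => p.2.proj) :=
    (FiberBundle.continuous_proj V.F V.Fib).comp continuous_snd
  filter_upwards [hcont.continuousAt.preimage_mem_nhds
    (e.open_baseSet.mem_nhds (FiberBundle.mem_baseSet_trivializationAt' p₀.2.proj))] with p hp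
  have := (e.linear ℝ hp).map_smul p.1 p.2.2
  exact this

/-- The parametrisation of a fibre by the model fibre is smooth. -/
theorem contMDiff_symm_fiber (V : SmoothVB I M) (m : M) :
    ContMDiff 𝓘(ℝ, V.F) (I.prod 𝓘(ℝ, V.F)) ∞
      (fun v : V.F => (⟨m, (trivializationAt V.F V.Fib m).symm m v⟩ : V.Tot)) := by
  let e := trivializationAt V.F V.Fib m
  have hm : m ∈ e.baseSet := FiberBundle.mem_baseSet_trivializationAt' m
  intro v
  have h3 := (e.contMDiffOn_symm (IB := I) (n := ∞)).contMDiffAt (x := (m, v))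
    (e.open_target.mem_nhds (by rw [e.mem_target]; exact hm))
  refine (h3.comp v (contMDiffAt_const.prodMk contMDiffAt_id)).congr_of_eventuallyEq ?_
  filter_upwards with w
  exact e.mk_symm hm w

/-- A smooth fibrewise homogeneous function is fibrewise additive. -/
theorem add_of_homogeneous {V : SmoothVB I M} {g : V.Tot → ℝ}
    (hg : ContMDiff (I.prod 𝓘(ℝ, V.F)) 𝓘(ℝ, ℝ) ∞ g)
    (hs : ∀ (t : ℝ) (x : V.Tot), g (tsmul t x) = t * g x) (m : M) (u v : V.Fib m) :
    g ⟨m, u + v⟩ = g ⟨m, u⟩ + g ⟨m, v⟩ := by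
  let e := trivializationAt V.F V.Fib m
  have hm : m ∈ e.baseSet := FiberBundle.mem_baseSet_trivializationAt' m
  let k : V.F → ℝ := fun w => g ⟨m, e.symmL ℝ m w⟩
  have hk : ContDiff ℝ ∞ k := by
    have := (hg.comp (V.contMDiff_symm_fiber m)).contDiff
    have hc : k = g ∘ (fun v : V.F => (⟨m, e.symm m v⟩ : V.Tot)) := by
      funext w
      simp only [k, Function.comp, Trivialization.symmL_apply e hm]
    rwa [hc]
  have hh : ∀ (t : ℝ) (w : V.F), k (t • w) = t * k w := fun t w => by
    simp only [k, map_smul]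
    exact hs t ⟨m, e.symmL ℝ m w⟩
  -- Differentiating `k (t w) = t k w` at `t = 0` shows that `k` equals its own derivative at the
  -- origin, hence is linear.
  have hd : ∀ w, k w = fderiv ℝ k 0 w := fun w => by
    have h0 : DifferentiableAt ℝ k 0 := hk.differentiable (by simp) 0
    have h1 : HasDerivAt (fun t : ℝ => t • w) w 0 := by
      simpa using (hasDerivAt_id (0 : ℝ)).smul_const w
    have h2 : HasDerivAt (fun t : ℝ => k (t • w)) (fderiv ℝ k 0 w) 0 := by
      have h3 : HasFDerivAt k (fderiv ℝ k 0) ((0 : ℝ) • w) := by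
        rw [zero_smul]; exact h0.hasFDerivAt
      exact h3.comp_hasDerivAt 0 h1
    have h4 : HasDerivAt (fun t : ℝ => k (t • w)) (k w) 0 := by
      simp only [hh]
      simpa using (hasDerivAt_id (0 : ℝ)).mul_const (k w)
    exact h4.unique h2
  have hkg : ∀ x : V.Fib m, g ⟨m, x⟩ = k (e.continuousLinearMapAt ℝ m x) := fun x => by
    simp only [k]
    rw [e.symmL_continuousLinearMapAt hm]
  rw [hkg, hkg, hkg, map_add, hd, hd (e.continuousLinearMapAt ℝ m u),
    hd (e.continuousLinearMapAt ℝ m v), map_add]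

/-- The fibrewise derivative at zero of a function on the total space. -/
def linPart {V : SmoothVB I M} (g : V.Tot → ℝ) (x : V.Tot) : ℝ :=
  deriv (fun t : ℝ => g (tsmul t x)) 0

section linPart
variable {V : SmoothVB I M} {g : V.Tot → ℝ}

theorem contDiff_comp_tsmul (hg : ContMDiff (I.prod 𝓘(ℝ, V.F)) 𝓘(ℝ, ℝ) ∞ g) (x : V.Tot) :
    ContDiff ℝ ∞ (fun t : ℝ => g (tsmul t x)) :=
  ((hg.comp V.contMDiff_tsmul).comp
    (contMDiff_id.prodMk (contMDiff_const (c := x)))).contDiff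

theorem hasDerivAt_linPart (hg : ContMDiff (I.prod 𝓘(ℝ, V.F)) 𝓘(ℝ, ℝ) ∞ g) (x : V.Tot) :
    HasDerivAt (fun t : ℝ => g (tsmul t x)) (linPart g x) 0 :=
  ((contDiff_comp_tsmul hg x).differentiable (by simp) 0).hasDerivAt

theorem linPart_contMDiff [IsManifold I ∞ M]
    (hg : ContMDiff (I.prod 𝓘(ℝ, V.F)) 𝓘(ℝ, ℝ) ∞ g) :
    ContMDiff (I.prod 𝓘(ℝ, V.F)) 𝓘(ℝ, ℝ) ∞ (linPart g) := by
  intro x₀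
  have h := ContMDiffAt.mfderiv (I := 𝓘(ℝ, ℝ)) (I' := 𝓘(ℝ, ℝ)) (J := I.prod 𝓘(ℝ, V.F))
    (n := ∞) (m := ∞) (x₀ := x₀)
    (fun (x : V.Tot) (t : ℝ) => g (tsmul t x)) (fun _ => (0 : ℝ))
    (((hg.comp V.contMDiff_tsmul).comp (contMDiff_snd.prodMk contMDiff_fst)).contMDiffAt)
    contMDiffAt_const (by simp)
  -- Over the model space `ℝ` the tangent coordinates are trivial, so the derivative supplied by
  -- `ContMDiffAt.mfderiv` is the ordinary one.
  have h₁ : ContMDiffAt (I.prod 𝓘(ℝ, V.F)) 𝓘(ℝ, ℝ →L[ℝ] ℝ) ∞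
      (fun x : V.Tot => (fderiv ℝ (fun t : ℝ => g (tsmul t x)) 0 : ℝ →L[ℝ] ℝ)) x₀ := by
    refine h.congr_of_eventuallyEq (.of_forall fun x => ?_)
    refine mfderiv_eq_fderiv.symm.trans ?_
    exact (congrFun (inTangentCoordinates_model_space (I := 𝓘(ℝ, ℝ)) (I' := 𝓘(ℝ, ℝ))
      (fun _ : V.Tot => (0 : ℝ)) (fun x => g (tsmul 0 x))
      (fun x => mfderiv 𝓘(ℝ, ℝ) 𝓘(ℝ, ℝ) (fun t : ℝ => g (tsmul t x)) 0) x₀) x).symm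
  have h' := h₁.clm_apply (contMDiffAt_const (c := (1 : ℝ)))
  refine h'.congr_of_eventuallyEq ?_
  exact .of_forall fun x => rfl

theorem linPart_tsmul (hg : ContMDiff (I.prod 𝓘(ℝ, V.F)) 𝓘(ℝ, ℝ) ∞ g) (s : ℝ) (x : V.Tot) :
    linPart g (tsmul s x) = s * linPart g x := by
  have h1 : HasDerivAt (fun t : ℝ => t * s) s 0 := by
    simpa using (hasDerivAt_id (0 : ℝ)).mul_const s
  have h2 : HasDerivAt (fun t : ℝ => g (tsmul t x)) (linPart g x) (0 * s) := by
    rw [zero_mul]; exact hasDerivAt_linPart hg x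
  have h3 := h2.comp (0 : ℝ) h1
  have h4 : (fun t : ℝ => g (tsmul t (tsmul s x))) = (fun t => g (tsmul t x)) ∘ (fun t => t * s) := by
    funext t
    exact congrArg (fun u => g ⟨x.proj, u⟩) (smul_smul t s x.2)
  rw [linPart, h4, h3.deriv, mul_comm]

/-- The fibrewise derivative at zero, as a section of the dual. -/
def linSec [IsManifold I ∞ M] (hg : ContMDiff (I.prod 𝓘(ℝ, V.F)) 𝓘(ℝ, ℝ) ∞ g) : V.dual.Sec :=
  secOfFun (linPart g) (linPart_contMDiff hg)
    (add_of_homogeneous (linPart_contMDiff hg) (linPart_tsmul hg))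
    (fun m t u => linPart_tsmul hg t ⟨m, u⟩)

end linPart

theorem exists_bump [FiniteDimensional ℝ E] [IsManifold I ∞ M] [T2Space M] (x₀ : M) {U : Set M}
    (hU : U ∈ 𝓝 x₀) : ∃ ρ : C^∞⟮I, M; ℝ⟯, ρ x₀ = 1 ∧ tsupport ρ ⊆ U := by
  obtain ⟨f, -, hf⟩ := ((SmoothBumpFunction.nhds_basis_tsupport (I := I) x₀).mem_iff).1 hU
  exact ⟨⟨f, f.contMDiff⟩, f.eq_one, hf⟩

/-- A finite family of sections of a vector bundle and of its dual that are, up to a cut-off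
function, dual frames near a given point. -/
theorem exists_dual_frames [FiniteDimensional ℝ E] [IsManifold I ∞ M] [T2Space M]
    (V : SmoothVB I M) (x₀ : M) :
    ∃ (k : ℕ) (ρ : C^∞⟮I, M; ℝ⟯) (g : Fin k → V.dual.Sec) (s : Fin k → V.Sec), ρ x₀ = 1 ∧
      ∀ (m : M) (x : V.Fib m), (ρ m * ρ m) • x = ∑ i, linFun (g i) ⟨m, x⟩ • s i m := by
  let e := trivializationAt V.F V.Fib x₀
  let b := Module.finBasis ℝ V.F
  obtain ⟨ρ, hρ, hsupp⟩ := exists_bump (I := I) x₀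
    (e.open_baseSet.mem_nhds (FiberBundle.mem_baseSet_trivializationAt' x₀))
  have hs : ∀ i, ContMDiff I (I.prod 𝓘(ℝ, V.F)) ∞
      (fun m => (⟨m, ρ m • e.localFrame b i m⟩ : V.Tot)) := fun i =>
    ContMDiffOn.smul_section_of_tsupport (ψ := ρ) (s := e.localFrame b i) ρ.contMDiff.contMDiffOn
      e.open_baseSet hsupp (e.contMDiffOn_localFrame_baseSet ∞ b i)
  have hzero : ∀ m, m ∉ e.baseSet → ρ m = 0 := fun m hm =>
    image_eq_zero_of_notMem_tsupport fun h => hm (hsupp h)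
  -- Both the frame and the coordinates are cut off by `ρ`, which produces the factor `ρ²`. Outside
  -- the base set the value of `e x` is meaningless, but `ρ` vanishes there.
  let c : Fin _ → V.Tot → ℝ := fun i x => ρ x.proj * b.coord i (e x).2
  have hc : ∀ i, ContMDiff (I.prod 𝓘(ℝ, V.F)) 𝓘(ℝ, ℝ) ∞ (c i) := fun i x => by
    by_cases hx : x.proj ∈ tsupport ρ
    · have h1 : ContMDiffAt (I.prod 𝓘(ℝ, V.F)) 𝓘(ℝ, V.F) ∞ (fun x : V.Tot => (e x).2) x := by
        have h2 := (e.contMDiffOn (IB := I) (n := ∞)).contMDiffAt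
          (e.open_source.mem_nhds (e.mem_source.2 (hsupp hx)))
        exact h2.snd
      have h3 : ContMDiff 𝓘(ℝ, V.F) 𝓘(ℝ, ℝ) ∞ (b.coord i) :=
        (LinearMap.toContinuousLinearMap (b.coord i)).contDiff.contMDiff
      exact ((ρ.contMDiff.comp (contMDiff_proj V.Fib)).contMDiffAt).mul
        (h3.contMDiffAt.comp x h1)
    · refine (contMDiffAt_const (c := (0 : ℝ))).congr_of_eventuallyEq ?_
      filter_upwards [(FiberBundle.continuous_proj V.F V.Fib).continuousAt.preimage_mem_nhds
        ((isClosed_tsupport ρ).isOpen_compl.mem_nhds hx)] with y hy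
      simp only [c]
      rw [image_eq_zero_of_notMem_tsupport hy, zero_mul]
  have hlin : ∀ i m, ∀ hm : m ∈ e.baseSet, ∀ x : V.Fib m,
      c i ⟨m, x⟩ = ρ m * b.coord i (e.linearEquivAt ℝ m hm x) := fun i m hm x => rfl
  refine ⟨_, ρ, fun i => secOfFun (c i) (hc i) (fun m u v => ?_) (fun m t u => ?_),
    fun i => ⟨fun m => ρ m • e.localFrame b i m, hs i⟩, hρ, fun m x => ?_⟩
  · by_cases hm : m ∈ e.baseSet
    · rw [hlin _ _ hm, hlin _ _ hm, hlin _ _ hm, map_add, map_add, mul_add]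
    · simp only [c, hzero m hm, zero_mul, add_zero]
  · by_cases hm : m ∈ e.baseSet
    · rw [hlin _ _ hm, hlin _ _ hm, map_smul, map_smul, smul_eq_mul]
      ring
    · simp only [c, hzero m hm, zero_mul, mul_zero]
  · change _ = ∑ i, c i ⟨m, x⟩ • (ρ m • e.localFrame b i m)
    by_cases hm : m ∈ e.baseSet
    · have h1 : x = ∑ i, b.coord i (e.linearEquivAt ℝ m hm x) • e.localFrame b i m := by
        conv_lhs => rw [← (e.basisAt b hm).sum_repr x]
        refine Finset.sum_congr rfl fun i _ => ?_
        rw [e.localFrame_apply_of_mem_baseSet b hm]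
        rfl
      conv_lhs => rw [h1, Finset.smul_sum]
      refine Finset.sum_congr rfl fun i _ => ?_
      rw [hlin _ _ hm, smul_smul, smul_smul]
      ring_nf
    · simp [c, hzero m hm]

/-- Sections of the dual separate the points of the fibres. -/
theorem eq_of_linFun_eq [FiniteDimensional ℝ E] [IsManifold I ∞ M] [T2Space M] {V : SmoothVB I M}
    {x y : V.Tot} (h : x.proj = y.proj) (hxy : ∀ τ : V.dual.Sec, linFun τ x = linFun τ y) :
    x = y := by
  obtain ⟨m, x⟩ := x
  obtain ⟨m', y⟩ := y
  obtain rfl : m = m' := h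
  obtain ⟨k, ρ, g, s, hρ, hg⟩ := V.exists_dual_frames m
  have h1 := hg m x
  have h2 := hg m y
  simp only [hρ, mul_one, one_smul, hxy] at h1 h2
  rw [h1, ← h2]

/-- A map to a vector bundle is smooth if its base map is, and if it has smooth composition with
enough fibrewise linear functions. -/
theorem contMDiffAt_of_linFun {V : SmoothVB I M}
    {E' H' : Type*} [NormedAddCommGroup E'] [NormedSpace ℝ E'] [TopologicalSpace H']
    {J : ModelWithCorners ℝ E' H'} {X : Type v} [TopologicalSpace X] [ChartedSpace H' X]
    {Ψ : X → V.Tot} (hproj : ContMDiff J I ∞ (fun y => (Ψ y).proj)) (y₀ : X)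
    (hsep : ∀ x : V.Fib (Ψ y₀).proj, (∀ s : V.dual.Sec,
      ContMDiff J 𝓘(ℝ, ℝ) ∞ (fun y => linFun s (Ψ y)) → linFun s ⟨_, x⟩ = 0) → x = 0) :
    ContMDiffAt J (I.prod 𝓘(ℝ, V.F)) ∞ Ψ y₀ := by
  set x₀ := (Ψ y₀).proj with hx₀
  let e := trivializationAt V.F V.Fib x₀
  let b := Module.finBasis ℝ V.F
  have hmem : x₀ ∈ e.baseSet := FiberBundle.mem_baseSet_trivializationAt' x₀
  have : FiniteDimensional ℝ (V.Fib x₀) := (e.linearEquivAt ℝ x₀ hmem).symm.finiteDimensional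
  -- The linear forms on the fibre over `x₀` that come from sections with smooth composition. They
  -- form a subspace that separates points, hence by finite dimension the whole dual.
  let W : Submodule ℝ (Module.Dual ℝ (V.Fib x₀)) :=
    { carrier := {φ | ∃ s : V.dual.Sec, ContMDiff J 𝓘(ℝ, ℝ) ∞ (fun y => linFun s (Ψ y)) ∧
        ∀ x, φ x = linFun s ⟨x₀, x⟩}
      add_mem' := by
        rintro φ ψ ⟨s, hs, hφ⟩ ⟨t, ht, hψ⟩
        exact ⟨s + t, hs.add ht, fun x => congrArg₂ (· + ·) (hφ x) (hψ x)⟩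
      zero_mem' := ⟨0, contMDiff_const, fun x => rfl⟩
      smul_mem' := by
        rintro r φ ⟨s, hs, hφ⟩
        exact ⟨r • s, contMDiff_const.mul hs, fun x => congrArg (r * ·) (hφ x)⟩ }
  have hW : W = ⊤ := by
    have h1 : W.dualCoannihilator = ⊥ := by
      rw [eq_bot_iff]
      intro x hx
      rw [Submodule.mem_dualCoannihilator] at hx
      refine hsep x fun s hs => ?_
      exact hx (LinearMap.mk ⟨fun x => linFun s ⟨x₀, x⟩, (s x₀).map_add⟩ (s x₀).map_smul)
        ⟨s, hs, fun _ => rfl⟩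
    rw [← Subspace.dualCoannihilator_dualAnnihilator_eq (W := W), h1,
      Submodule.dualAnnihilator_bot]
  have hsec : ∀ i, ∃ s : V.dual.Sec, ContMDiff J 𝓘(ℝ, ℝ) ∞ (fun y => linFun s (Ψ y)) ∧
      ∀ x, b.coord i (e.linearEquivAt ℝ x₀ hmem x) = linFun s ⟨x₀, x⟩ := fun i =>
    (hW ▸ Submodule.mem_top : (b.coord i).comp (e.linearEquivAt ℝ x₀ hmem).toLinearMap ∈ W)
  choose s hs hsx using hsec
  let T : Fin _ → M → V.F →L[ℝ] ℝ := fun i m => (trivializationAt V.dual.F V.dual.Fib x₀ (pt (s i) m)).2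
  have hT : ∀ i, ContMDiffAt I 𝓘(ℝ, V.F →L[ℝ] ℝ) ∞ (T i) x₀ := fun i =>
    (contMDiffAt_totalSpace.1 ((s i).contMDiff x₀)).2
  have hTv : ∀ i m, m ∈ e.baseSet → ∀ v, T i m v = linFun (s i) ⟨m, e.symmL ℝ m v⟩ := by
    intro i m hm v
    simp only [T, pt]
    rw [hom_trivializationAt_apply]
    simp [ContinuousLinearMap.inCoordinates, linFun, Trivial.continuousLinearMapAt_trivialization, e]
  -- The sections `s i` realise the coordinate forms at `x₀` only. `G m` expresses them in the
  -- trivialisation over `m`; it is the identity at `x₀`, so invertible nearby, and its inverse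
  -- recovers the coordinates of `Ψ y` from the smooth functions `linFun (s i) (Ψ y)`.
  let G : M → V.F →L[ℝ] V.F := fun m => ∑ i, (T i m).smulRight (b i)
  have hG : ContMDiffAt I 𝓘(ℝ, V.F →L[ℝ] V.F) ∞ G x₀ := by
    refine ContMDiffAt.sum fun i _ => ?_
    have := ((ContinuousLinearMap.smulRightL ℝ V.F V.F).flip (b i)).contDiff (n := ∞)
    exact this.contMDiff.contMDiffAt.comp x₀ (hT i)
  have hG0 : G x₀ = 1 := by
    ext v
    have h1 : ∀ i, T i x₀ v = b.repr v i := fun i => by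
      rw [hTv i x₀ hmem, ← hsx]
      have : e.linearEquivAt ℝ x₀ hmem (e.symmL ℝ x₀ v) = v := by
        rw [Trivialization.symmL_apply e hmem]
        exact (e.linearEquivAt ℝ x₀ hmem).apply_symm_apply v
      rw [this]
      rfl
    simp only [G, sum_apply, ContinuousLinearMap.smulRight_apply, h1]
    exact b.sum_repr v
  rw [contMDiffAt_totalSpace]
  refine ⟨hproj y₀, ?_⟩
  have hinv : ContMDiffAt J 𝓘(ℝ, V.F →L[ℝ] V.F) ∞ (fun y => Ring.inverse (G (Ψ y).proj)) y₀ := by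
    have h1 : ContDiffAt ℝ ∞ Ring.inverse (G x₀) := by
      rw [hG0]
      exact contDiffAt_ringInverse ℝ (1 : (V.F →L[ℝ] V.F)ˣ)
    exact h1.contMDiffAt.comp y₀ (hG.comp y₀ (hproj y₀))
  have hsum : ContMDiffAt J 𝓘(ℝ, V.F) ∞ (fun y => ∑ i, linFun (s i) (Ψ y) • b i) y₀ :=
    ContMDiffAt.sum fun i _ => (hs i y₀).smul contMDiffAt_const
  refine (hinv.clm_apply hsum).congr_of_eventuallyEq ?_
  have hcont : ContinuousAt (fun y => (Ψ y).proj) y₀ := (hproj y₀).continuousAt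
  have hU : ∀ᶠ m in 𝓝 x₀, IsUnit (G m) := by
    refine hG.continuousAt.eventually (?_ : ∀ᶠ a in 𝓝 (G x₀), IsUnit a)
    rw [hG0]
    exact Units.isOpen.mem_nhds isUnit_one
  filter_upwards [hcont.eventually hU, hcont.preimage_mem_nhds (e.open_baseSet.mem_nhds hmem)]
    with y hy1 hy2
  have h2 : G (Ψ y).proj (e (Ψ y)).2 = ∑ i, linFun (s i) (Ψ y) • b i := by
    simp only [G, sum_apply, ContinuousLinearMap.smulRight_apply]
    refine Finset.sum_congr rfl fun i _ => ?_
    rw [hTv i _ hy2]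
    have : e.symmL ℝ (Ψ y).proj (e (Ψ y)).2 = (Ψ y).2 := by
      rw [Trivialization.symmL_apply e hy2]
      exact (e.linearEquivAt ℝ _ hy2).symm_apply_apply (Ψ y).2
    rw [this]
  rw [← h2, ← mul_apply_eq_comp, Ring.inverse_mul_cancel _ hy1]
  rfl

end SmoothVB

/-! ### Fibrewise arithmetic and global sections -/

namespace SmoothVB

variable {E H : Type*} [NormedAddCommGroup E] [NormedSpace ℝ E] [TopologicalSpace H]
  {I : ModelWithCorners ℝ E H} {M : Type u} [TopologicalSpace M] [ChartedSpace H M]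
  {V : SmoothVB I M}

theorem tadd_of_homogeneous {g : V.Tot → ℝ}
    (hg : ContMDiff (I.prod 𝓘(ℝ, V.F)) 𝓘(ℝ, ℝ) ∞ g)
    (hs : ∀ (t : ℝ) (x : V.Tot), g (tsmul t x) = t * g x) {x y : V.Tot} (h : x.proj = y.proj) :
    g (tadd x y) = g x + g y := by
  obtain ⟨m, x⟩ := x
  obtain ⟨m', y⟩ := y
  obtain rfl : m = m' := h
  rw [tadd_mk]
  exact add_of_homogeneous hg hs m x y

theorem one_tsmul (x : V.Tot) : tsmul 1 x = x := by
  rw [tsmul, one_smul]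

theorem tsmul_tsmul (s t : ℝ) (x : V.Tot) : tsmul s (tsmul t x) = tsmul (s * t) x :=
  congrArg (fun u => (⟨x.proj, u⟩ : V.Tot)) (smul_smul s t x.2)

theorem tsmul_proj (t : ℝ) (x : V.Tot) : (tsmul t x).proj = x.proj := rfl

theorem tadd_tsmul (s t : ℝ) (x : V.Tot) : tadd (tsmul s x) (tsmul t x) = tsmul (s + t) x := by
  rw [tsmul, tsmul, tadd_mk, tsmul, add_smul]

theorem tadd_comm {x y : V.Tot} (h : x.proj = y.proj) : tadd x y = tadd y x := by
  obtain ⟨m, x⟩ := x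
  obtain ⟨m', y⟩ := y
  obtain rfl : m = m' := h
  rw [tadd_mk, tadd_mk, add_comm]

theorem tadd_tadd_neg {x y : V.Tot} (h : x.proj = y.proj) :
    tadd y (tadd x (tsmul (-1) y)) = x := by
  obtain ⟨m, x⟩ := x
  obtain ⟨m', y⟩ := y
  obtain rfl : m = m' := h
  rw [tsmul_mk, tadd_mk, tadd_mk]
  simp

theorem tadd_tsmul_neg_one (x : V.Tot) : tadd x (tsmul (-1) x) = tzero V x.proj := by
  obtain ⟨m, x⟩ := x
  rw [tsmul_mk, tadd_mk]
  simp [tzero]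

theorem tzero_tadd {m : M} {x : V.Tot} (h : x.proj = m) : tadd (tzero V m) x = x := by
  subst h
  exact (tadd_comm (x := tzero V x.proj) (y := x) rfl).trans (tadd_tzero x)

theorem sec_sum_apply {ι : Type*} (S : Finset ι) (f : ι → V.Sec) (m : M) :
    (∑ i ∈ S, f i) m = ∑ i ∈ S, f i m := by
  classical
  induction S using Finset.induction_on with
  | empty => rfl
  | insert a S ha h =>
    rw [Finset.sum_insert ha, Finset.sum_insert ha, ← h]
    rfl

/-- Every point of a vector bundle lies on a global section. -/
theorem exists_sec_through [FiniteDimensional ℝ E] [IsManifold I ∞ M] [T2Space M] (x : V.Tot) :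
    ∃ s : V.Sec, pt s x.proj = x := by
  obtain ⟨k, ρ, g, s, hρ, hg⟩ := V.exists_dual_frames x.proj
  have h1 := hg _ x.2
  rw [hρ, mul_one, one_smul] at h1
  refine ⟨∑ i, linFun (g i) x • s i, congrArg (fun z => (⟨x.proj, z⟩ : V.Tot)) ?_⟩
  rw [sec_sum_apply]
  exact h1.symm

theorem contMDiff_tzero (V : SmoothVB I M) :
    ContMDiff I (I.prod 𝓘(ℝ, V.F)) ∞ (tzero V) :=
  contMDiff_zeroSection ℝ V.Fib

theorem contMDiff_pt (s : V.Sec) : ContMDiff I (I.prod 𝓘(ℝ, V.F)) ∞ (pt s) :=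
  s.contMDiff

end SmoothVB

/-! ### Double vector bundles: zero sections, the core, surjectivity onto both sides -/

namespace DoubleVectorBundle
variable {n : ℕ} {M : Type u} [TopologicalSpace M] [ChartedSpace (EuclideanSpace ℝ (Fin n)) M]
  {A B : SmoothVB (𝓡 n) M} (D : DoubleVectorBundle A B)

/-- The zero section of `D → B`. -/
def zero₂ (b : B.Tot) : D.Tot := D.ident.symm (tzero D.over₂ b)

theorem ident_inj {d d' : D.Tot} (h : D.ident d = D.ident d') : d = d' :=
  D.ident.injective h

variable {D} in
theorem ident_smul₂ (t : ℝ) (d : D.Tot) : D.ident (smul₂ t d) = tsmul t (D.ident d) :=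
  D.ident.apply_symm_apply _

variable {D} in
theorem ident_add₂ (d d' : D.Tot) : D.ident (add₂ d d') = tadd (D.ident d) (D.ident d') :=
  D.ident.apply_symm_apply _

theorem π₂_zero₂ (b : B.Tot) : π₂ (D.zero₂ b) = b :=
  congrArg TotalSpace.proj (D.ident.apply_symm_apply (tzero D.over₂ b))

theorem smul₂_zero (d : D.Tot) : smul₂ 0 d = D.zero₂ (π₂ d) :=
  congrArg D.ident.symm (zero_tsmul (D.ident d))

theorem smul₁_zero (d : D.Tot) : smul₁ 0 d = D.zero₁ (π₁ d) :=
  zero_tsmul (V := D.over₁) d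

theorem π₁_zero₂ (b : B.Tot) : π₁ (D.zero₂ b) = tzero A b.proj := by
  have h := D.π₁_smul₂ 0 (D.zero₂ b)
  rw [smul₂_zero, π₂_zero₂, zero_tsmul, D.square, π₂_zero₂] at h
  exact h

theorem π₁_add₁ (d d' : D.Tot) : π₁ (add₁ d d') = π₁ d := tadd_proj d d'

theorem π₁_smul₁ (t : ℝ) (d : D.Tot) : π₁ (smul₁ t d) = π₁ d := rfl

theorem π₂_smul₁ (t : ℝ) (d : D.Tot) : π₂ (smul₁ t d) = tsmul t (π₂ d) := D.proj₂.map_smul t d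

theorem π₁_zero₁ (a : A.Tot) : π₁ (D.zero₁ a) = a := rfl

/-- Both sides are obtained by applying the two commuting multiplications by `0` to one element. -/
theorem zero₁_tzero (m : M) : D.zero₁ (tzero A m) = D.zero₂ (tzero B m) := by
  have h := D.smul₂_smul₁ 0 0 (D.zero₁ (tzero A m))
  rw [smul₂_zero, π₂_smul₁, π₂_zero₁, smul₁_zero, π₁_smul₂, π₁_zero₁, tsmul_tzero,
    tsmul_tzero] at h
  exact h.symm

theorem zero₂_tadd (b b' : B.Tot) (h : b.proj = b'.proj) :
    D.zero₂ (tadd b b') = add₁ (D.zero₂ b) (D.zero₂ b') := by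
  have h1 : π₁ (D.zero₂ b) = π₁ (D.zero₂ b') := by rw [π₁_zero₂, π₁_zero₂, h]
  have h2 := D.smul₂_add₁ 0 _ _ h1
  rw [smul₂_zero, smul₂_zero, smul₂_zero, π₂_add₁ _ _ _ h1, π₂_zero₂, π₂_zero₂] at h2
  exact h2

theorem zero₂_tsmul (t : ℝ) (b : B.Tot) : D.zero₂ (tsmul t b) = smul₁ t (D.zero₂ b) := by
  have h2 := D.smul₂_smul₁ 0 t (D.zero₂ b)
  rw [smul₂_zero, smul₂_zero, π₂_smul₁, π₂_zero₂] at h2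
  exact h2

/-- `d` lies in the core, over `m`. -/
def IsCore (m : M) (d : D.Tot) : Prop := π₁ d = tzero A m ∧ π₂ d = tzero B m

variable {D} in
theorem IsCore.smul₂ {m : M} {c : D.Tot} (hc : D.IsCore m c) (t : ℝ) : D.IsCore m (smul₂ t c) :=
  ⟨by rw [D.π₁_smul₂, hc.1, tsmul_tzero], by rw [D.π₂_smul₂, hc.2]⟩

theorem add₁_zero₁ {d : D.Tot} {a : A.Tot} (h : π₁ d = a) : add₁ d (D.zero₁ a) = d := by
  subst h
  exact tadd_tzero d

theorem zero₁_add₁ {d : D.Tot} {a : A.Tot} (h : π₁ d = a) : add₁ (D.zero₁ a) d = d :=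
  tzero_tadd h

theorem add₂_zero₂ {d : D.Tot} {b : B.Tot} (h : π₂ d = b) : add₂ d (D.zero₂ b) = d := by
  subst h
  apply D.ident_inj
  rw [ident_add₂]
  exact (congrArg _ (D.ident.apply_symm_apply _)).trans (tadd_tzero (D.ident d))

theorem zero₂_add₂ {d : D.Tot} {b : B.Tot} (h : π₂ d = b) : add₂ (D.zero₂ b) d = d := by
  apply D.ident_inj
  rw [ident_add₂]
  exact (congrArg (tadd · _) (D.ident.apply_symm_apply _)).trans (tzero_tadd h)

/-- The two additions agree on the core. -/
theorem add₂_eq_add₁ {m : M} {c c' : D.Tot} (hc : D.IsCore m c) (hc' : D.IsCore m c') :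
    add₂ c c' = add₁ c c' := by
  have hz₁ := D.π₁_zero₁ (tzero A m)
  have hz₂ : π₂ (D.zero₁ (tzero A m)) = tzero B m := D.π₂_zero₁ _
  -- Eckmann–Hilton: the interchange law for a square with the common double zero off the diagonal.
  have h := D.interchange c (D.zero₁ (tzero A m)) (D.zero₁ (tzero A m)) c'
    (hc.1.trans hz₁.symm) (hz₁.trans hc'.1.symm) (hc.2.trans hz₂.symm) (hz₂.trans hc'.2.symm)
  rw [D.add₁_zero₁ hc.1, D.zero₁_add₁ hc'.1, D.zero₁_tzero, D.add₂_zero₂ hc.2,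
    D.zero₂_add₂ hc'.2] at h
  exact h

theorem add₂_smul₂ (s t : ℝ) (d : D.Tot) : add₂ (smul₂ s d) (smul₂ t d) = smul₂ (s + t) d := by
  apply D.ident_inj
  rw [ident_add₂, ident_smul₂, ident_smul₂, ident_smul₂, tadd_tsmul]

theorem one_smul₂ (d : D.Tot) : smul₂ 1 d = d := by
  apply D.ident_inj
  rw [ident_smul₂, one_tsmul]

/-- The manifold model of `D`. -/
abbrev model := ((𝓡 n).prod 𝓘(ℝ, A.F)).prod 𝓘(ℝ, D.over₁.F)

theorem contMDiff_zero₂ : ContMDiff ((𝓡 n).prod 𝓘(ℝ, B.F)) D.model ∞ D.zero₂ :=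
  D.ident.symm.contMDiff.comp (contMDiff_tzero D.over₂)

theorem contMDiff_π₁ : ContMDiff D.model ((𝓡 n).prod 𝓘(ℝ, A.F)) ∞ (fun d : D.Tot => π₁ d) :=
  contMDiff_proj D.over₁.Fib

theorem contMDiff_π₂ : ContMDiff D.model ((𝓡 n).prod 𝓘(ℝ, B.F)) ∞ (fun d : D.Tot => π₂ d) :=
  D.proj₂.smooth

theorem contMDiff_smul₂ : ContMDiff (𝓘(ℝ, ℝ).prod D.model) D.model ∞
    (fun p : ℝ × D.Tot => smul₂ p.1 p.2) :=
  D.ident.symm.contMDiff.comp (D.over₂.contMDiff_tsmul.comp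
    (contMDiff_fst.prodMk (D.ident.contMDiff.comp contMDiff_snd)))

theorem continuous_smul₂ (d : D.Tot) : Continuous (fun t : ℝ => smul₂ t d) :=
  D.contMDiff_smul₂.continuous.comp (continuous_id.prodMk continuous_const)

/-- The two scalar multiplications agree on the core. -/
theorem linFun_smul₂_core {m : M} {c : D.Tot} (hc : D.IsCore m c) (s : D.over₁.dual.Sec) (t : ℝ) :
    linFun s (smul₂ t c) = t * linFun s c := by
  -- Since the additions agree on the core, this map is additive; it is also continuous, hence
  -- real-linear.
  let φ : ℝ →+ ℝ := AddMonoidHom.mk' (fun t => linFun s (smul₂ t c)) fun a b => by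
    change linFun s (smul₂ (a + b) c) = linFun s (smul₂ a c) + linFun s (smul₂ b c)
    rw [← add₂_smul₂, add₂_eq_add₁ D (hc.smul₂ a) (hc.smul₂ b)]
    exact linFun_tadd s _ _ ((hc.smul₂ a).1.trans (hc.smul₂ b).1.symm)
  have hφ : Continuous φ := (linFun_contMDiff s).continuous.comp (D.continuous_smul₂ c)
  have h := map_real_smul φ hφ t 1
  have h1 : φ 1 = linFun s c := congrArg (linFun s) (D.one_smul₂ c)
  rw [smul_eq_mul, smul_eq_mul, mul_one, h1] at h
  exact h

/-- The map `D → A ×_M B` is surjective. -/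
theorem exists_over [IsManifold (𝓡 n) ∞ M] [T2Space M] (a : A.Tot) (b : B.Tot)
    (h : a.proj = b.proj) : ∃ d : D.Tot, π₁ d = a ∧ π₂ d = b := by
  obtain ⟨m, b⟩ := b
  have := t2Space_tot A
  -- The elements of `B_m` that are reached from points over `a`. If `b` were not among them, a
  -- linear form would separate it from `S`.
  let S : Submodule ℝ (B.Fib m) :=
    { carrier := {b' | ∃ d : D.Tot, π₁ d = a ∧ π₂ d = ⟨m, b'⟩}
      add_mem' := by
        rintro x y ⟨d, hd, hd'⟩ ⟨e, he, he'⟩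
        refine ⟨add₁ d e, (D.π₁_add₁ d e).trans hd, ?_⟩
        rw [D.π₂_add₁ _ _ (hd.trans he.symm), hd', he', tadd_mk]
      zero_mem' := ⟨D.zero₁ a, rfl, by rw [D.π₂_zero₁, h]; rfl⟩
      smul_mem' := by
        rintro t x ⟨d, hd, hd'⟩
        exact ⟨smul₁ t d, hd, by rw [D.π₂_smul₁, hd']; rfl⟩ }
  suffices hb : b ∈ S from hb
  by_contra hb
  obtain ⟨φ, hφb, hφ⟩ := S.exists_le_ker_of_notMem hb
  obtain ⟨k, ρ, g, s, hρ, hg⟩ := B.exists_dual_frames m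
  -- A continuous extension of `φ` from the fibre over `m` to all of `B`.
  let τ : B.Tot → ℝ := fun x => ∑ i, φ (s i m) * linFun (g i) x
  have hτ : Continuous τ := continuous_finsetSum _ fun i _ =>
    continuous_const.mul (linFun_contMDiff (g i)).continuous
  have hτφ : ∀ x, τ ⟨m, x⟩ = φ x := fun x => by
    have h1 := congrArg φ (hg m x)
    rw [hρ, mul_one, one_smul, map_sum] at h1
    rw [h1]
    exact Finset.sum_congr rfl fun i _ => by rw [map_smul, smul_eq_mul, mul_comm]
  obtain ⟨σ, hσ⟩ := exists_sec_through (D.zero₂ ⟨m, b⟩)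
  have h0 : (D.zero₂ ⟨m, b⟩).proj = tzero A m := D.π₁_zero₂ _
  rw [h0] at hσ
  -- A section `σ` of `D → A` through the zero over `b` is followed along the ray `t a`. For `t ≠ 0`
  -- the point `σ (t a)` can be rescaled by `t⁻¹` in `D → B`: it then lies over `a` with unchanged
  -- `π₂`, so `γ t = 0`. At `t = 0` the value is `φ b`, and continuity gives the contradiction.
  let γ : ℝ → ℝ := fun t => τ (π₂ (D := D.toDoubleBundle) (pt σ (tsmul t a)))
  have hγ : Continuous γ := by
    refine hτ.comp (D.contMDiff_π₂.continuous.comp ((contMDiff_pt σ).continuous.comp ?_))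
    exact A.contMDiff_tsmul.continuous.comp (continuous_id.prodMk continuous_const)
  have hγ0 : γ 0 = φ b := by
    simp only [γ]
    rw [zero_tsmul, h, hσ, D.π₂_zero₂, hτφ]
  have hγt : ∀ t, t ≠ 0 → γ t = 0 := fun t ht => by
    let d : D.Tot := smul₂ t⁻¹ (pt σ (tsmul t a))
    have h1 : π₁ d = a := by
      refine (D.π₁_smul₂ _ _).trans ?_
      change tsmul t⁻¹ (tsmul t a) = a
      rw [tsmul_tsmul, inv_mul_cancel₀ ht, one_tsmul]
    have h2 : π₂ d = π₂ (D := D.toDoubleBundle) (pt σ (tsmul t a)) := D.π₂_smul₂ _ _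
    have h3 : (π₂ d).proj = m := by rw [← D.square, h1, h]
    simp only [γ]
    rw [← h2]
    generalize hz : π₂ d = z at h3
    obtain ⟨q, z⟩ := z
    obtain rfl : q = m := h3
    rw [hτφ]
    exact hφ ⟨d, h1, hz⟩
  have h4 : γ = fun _ => 0 := hγ.ext_on (dense_compl_singleton (0 : ℝ)) continuous_const hγt
  exact hφb (hγ0.symm.trans (congrFun h4 0))

end DoubleVectorBundle

/-! ### Doubly linear functions and their local generators -/

namespace DoubleVectorBundle
variable {n : ℕ} {M : Type u} [TopologicalSpace M] [ChartedSpace (EuclideanSpace ℝ (Fin n)) M]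
  {A B : SmoothVB (𝓡 n) M} (D : DoubleVectorBundle A B)

/-- `f` is a smooth function on `D` that is linear for both vector bundle structures. -/
structure IsBilinear (f : D.Tot → ℝ) : Prop where
  smooth : ContMDiff D.model 𝓘(ℝ, ℝ) ∞ f
  add₁ : ∀ d d', π₁ d = π₁ d' → f (add₁ d d') = f d + f d'
  smul₁ : ∀ t d, f (smul₁ t d) = t * f d
  add₂ : ∀ d d', π₂ d = π₂ d' → f (add₂ d d') = f d + f d'
  smul₂ : ∀ t d, f (smul₂ t d) = t * f d

namespace IsBilinear
variable {D} {f : D.Tot → ℝ} (hf : D.IsBilinear f)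
include hf

theorem zero₁ (a : A.Tot) : f (D.zero₁ a) = 0 := by
  have h := hf.smul₁ 0 (D.zero₁ a)
  rwa [smul₁_zero, zero_mul] at h

theorem zero₂ (b : B.Tot) : f (D.zero₂ b) = 0 := by
  have h := hf.smul₂ 0 (D.zero₂ b)
  rwa [smul₂_zero, zero_mul, D.π₂_zero₂] at h

end IsBilinear

/-- A bilinear function, as a section of the dual of `D → A`. -/
def IsBilinear.sec {D : DoubleVectorBundle A B} {f : D.Tot → ℝ} (hf : D.IsBilinear f) :
    D.over₁.dual.Sec :=
  secOfFun f hf.smooth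
    (fun a u v => by
      have h := hf.add₁ ⟨a, u⟩ ⟨a, v⟩ rfl
      rwa [DoubleBundle.add₁, tadd_mk] at h)
    (fun a t u => hf.smul₁ t ⟨a, u⟩)

variable {D} in
theorem IsBilinear.linFun_sec {f : D.Tot → ℝ} (hf : D.IsBilinear f) (d : D.Tot) :
    linFun hf.sec d = f d := rfl

/-- The derivative of the function of a section of the dual of `D → A` along the scalar
multiplication of `D → B`. -/
def bilin (s : D.over₁.dual.Sec) (d : D.Tot) : ℝ :=
  linPart (fun x => linFun s (D.ident.symm x)) (D.ident d)

section bilin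
variable {D} [IsManifold (𝓡 n) ∞ M] (s : D.over₁.dual.Sec)

omit [IsManifold (𝓡 n) ∞ M] in
theorem contMDiff_linFun_symm :
    ContMDiff (((𝓡 n).prod 𝓘(ℝ, B.F)).prod 𝓘(ℝ, D.over₂.F)) 𝓘(ℝ, ℝ) ∞
      (fun x => linFun s (D.ident.symm x)) :=
  (linFun_contMDiff s).comp D.ident.symm.contMDiff

omit [IsManifold (𝓡 n) ∞ M] in
theorem hasDerivAt_bilin (d : D.Tot) :
    HasDerivAt (fun t : ℝ => linFun s (smul₂ t d)) (D.bilin s d) 0 :=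
  hasDerivAt_linPart (contMDiff_linFun_symm s) (D.ident d)

/-- Linearity over `A` survives because multiplication by `t` over `B` respects the structure over
`A`. Over `B` the derivative at `0` is homogeneous, and a smooth homogeneous function is additive.
-/
theorem isBilinear_bilin : D.IsBilinear (D.bilin s) where
  smooth := (linPart_contMDiff (contMDiff_linFun_symm s)).comp D.ident.contMDiff
  add₁ d d' h := by
    refine (hasDerivAt_bilin s _).unique
      (((hasDerivAt_bilin s d).add (hasDerivAt_bilin s d')).congr_of_eventuallyEq
        (.of_forall fun t => ?_))
    simp only [Pi.add_apply]
    rw [D.smul₂_add₁ t d d' h]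
    exact linFun_tadd s _ _ (by
      change π₁ (smul₂ t d) = π₁ (smul₂ t d')
      rw [D.π₁_smul₂, D.π₁_smul₂, h])
  smul₁ r d := by
    refine (hasDerivAt_bilin s _).unique
      (((hasDerivAt_bilin s d).const_mul r).congr_of_eventuallyEq (.of_forall fun t => ?_))
    simp only []
    rw [D.smul₂_smul₁]
    exact linFun_tsmul s r _
  add₂ d d' h := by
    rw [bilin, ident_add₂]
    exact tadd_of_homogeneous (linPart_contMDiff (contMDiff_linFun_symm s))
      (linPart_tsmul (contMDiff_linFun_symm s)) h
  smul₂ t d := by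
    rw [bilin, ident_smul₂]
    exact linPart_tsmul (contMDiff_linFun_symm s) t _

omit [IsManifold (𝓡 n) ∞ M] in
theorem bilin_core {m : M} {c : D.Tot} (hc : D.IsCore m c) : D.bilin s c = linFun s c := by
  refine (hasDerivAt_bilin s c).unique ?_
  simp only [D.linFun_smul₂_core hc]
  simpa using (hasDerivAt_id (0 : ℝ)).mul_const (linFun s c)

omit [IsManifold (𝓡 n) ∞ M] in
-- The product rule along `t ↦ smul₂ t d`, a curve that starts at the zero over `π₂ d` and whose
-- first projection is the ray `t (π₁ d)`.
theorem hasDerivAt_mul_linFun {h : A.Tot → ℝ}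
    (hh : ContMDiff ((𝓡 n).prod 𝓘(ℝ, A.F)) 𝓘(ℝ, ℝ) ∞ h) (d : D.Tot) :
    HasDerivAt (fun t : ℝ => h (π₁ (smul₂ t d)) * linFun s (smul₂ t d))
      (h (tzero A (π₁ d).proj) * D.bilin s d +
        linPart h (π₁ d) * linFun s (D.zero₂ (π₂ d))) 0 := by
  have h1 := (hasDerivAt_linPart hh (π₁ d)).mul (hasDerivAt_bilin s d)
  rw [zero_tsmul, smul₂_zero] at h1
  simp only [D.π₁_smul₂]
  convert! h1 using 1
  ring

/-- The section `b ↦ s (0_b)` of the dual of `B`. -/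
def onZero₂ (s : D.over₁.dual.Sec) : B.dual.Sec :=
  secOfFun (fun b => linFun s (D.zero₂ b)) ((linFun_contMDiff s).comp D.contMDiff_zero₂)
    (fun m u v => by
      have h := D.zero₂_tadd ⟨m, u⟩ ⟨m, v⟩ rfl
      rw [tadd_mk] at h
      rw [h]
      exact linFun_tadd s _ _ ((D.π₁_zero₂ ⟨m, u⟩).trans (D.π₁_zero₂ ⟨m, v⟩).symm))
    (fun m t u => by
      have h := D.zero₂_tsmul t ⟨m, u⟩
      rw [tsmul_mk] at h
      rw [h]
      exact linFun_tsmul s t _)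

end bilin

/-- Near a point of `M`, the bilinear functions are generated by finitely many of them and by the
products of linear functions on the sides. -/
theorem exists_generators [IsManifold (𝓡 n) ∞ M] [T2Space M] (m : M) :
    ∃ (k : ℕ) (ρ : C^∞⟮𝓡 n, M; ℝ⟯) (g : Fin k → D.over₁.dual.Sec)
      (v : Fin k → D.over₁.Fib (tzero A m)), ρ m = 1 ∧ ∀ f : D.Tot → ℝ, D.IsBilinear f →
        ∃ (h : Fin k → C^∞⟮𝓡 n, M; ℝ⟯) (σ : Fin k → A.dual.Sec),
          (∀ i, h i m = f ⟨tzero A m, v i⟩) ∧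
          ∀ d : D.Tot, ρ (π₁ d).proj * ρ (π₁ d).proj * f d =
            ∑ i, (h i (π₁ d).proj * D.bilin (g i) d +
              linFun (σ i) (π₁ d) * linFun (D.onZero₂ (g i)) (π₂ d)) := by
  have := t2Space_tot A
  obtain ⟨k, ρ, g, s, hρ, hg⟩ := D.over₁.exists_dual_frames (tzero A m)
  have hz := contMDiff_tzero A
  refine ⟨k, ⟨fun m => ρ (tzero A m), ρ.contMDiff.comp hz⟩, g, fun i => s i (tzero A m), hρ,
    fun f hf => ?_⟩
  have hh : ∀ i, ContMDiff ((𝓡 n).prod 𝓘(ℝ, A.F)) 𝓘(ℝ, ℝ) ∞ (fun a => f (pt (s i) a)) := fun i =>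
    hf.smooth.comp (contMDiff_pt (s i))
  -- The dual frame expansion over `A`, paired with `f`. Its coefficients are functions on `A`;
  -- differentiation along `smul₂` at `0` leaves their values and first derivatives on the zero
  -- section of `A`, that is, functions on `M` and linear functions on `A`.
  have hexp : ∀ d : D.Tot, ρ (π₁ d) * ρ (π₁ d) * f d =
      ∑ i, f (pt (s i) (π₁ d)) * linFun (g i) d := fun d => by
    obtain ⟨a, x⟩ := d
    have h1 := congrArg (hf.sec a) (hg a x)
    rw [map_smul, map_sum] at h1
    refine h1.trans (Finset.sum_congr rfl fun i _ => ?_)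
    rw [map_smul, smul_eq_mul, mul_comm]
    rfl
  refine ⟨fun i => ⟨fun m => f (pt (s i) (tzero A m)), (hh i).comp hz⟩, fun i => linSec (hh i),
    fun i => rfl, fun d => ?_⟩
  have hρρ : ContMDiff ((𝓡 n).prod 𝓘(ℝ, A.F)) 𝓘(ℝ, ℝ) ∞ (fun a => ρ a * ρ a) :=
    ρ.contMDiff.mul ρ.contMDiff
  have hl := hasDerivAt_mul_linFun hf.sec hρρ d
  have hr := HasDerivAt.fun_sum (u := Finset.univ)
    fun i _ => hasDerivAt_mul_linFun (g i) (hh i) d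
  have h1 := (hl.congr_of_eventuallyEq (.of_forall fun t => (hexp (smul₂ t d)).symm)).unique hr
  have h2 : D.bilin hf.sec d = f d := by
    refine (hasDerivAt_bilin hf.sec d).unique ?_
    simp only [hf.linFun_sec, hf.smul₂]
    simpa using (hasDerivAt_id (0 : ℝ)).mul_const (f d)
  -- The derivative of the cut-off drops out because its factor `f` vanishes on the zeros over `B`.
  rw [h2, hf.linFun_sec, hf.zero₂, mul_zero, add_zero] at h1
  exact h1

end DoubleVectorBundle

/-! ### Functionals on dual sections as points of a bundle -/

namespace SmoothVB

variable {E H : Type*} [NormedAddCommGroup E] [NormedSpace ℝ E] [TopologicalSpace H]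
  {I : ModelWithCorners ℝ E H} {M : Type u} [TopologicalSpace M] [ChartedSpace H M]
  {V : SmoothVB I M}

theorem linFun_sum_smul (τ : V.dual.Sec) {m : M} {k : ℕ} (c : Fin k → ℝ) (v : Fin k → V.Fib m) :
    linFun τ ⟨m, ∑ i, c i • v i⟩ = ∑ i, c i * linFun τ ⟨m, v i⟩ := by
  have h := map_sum (τ m) (fun i => c i • v i) Finset.univ
  exact h.trans (Finset.sum_congr rfl fun i _ => (τ m).map_smul (c i) (v i))

/-- A linear form on sections of the dual that is `C^∞(M)`-linear with respect to evaluation at a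
point is the evaluation on an element of the fibre. -/
theorem exists_eq_linFun [FiniteDimensional ℝ E] [IsManifold I ∞ M] [T2Space M] (m : M)
    (Λ : V.dual.Sec →+ ℝ) (hΛ : ∀ (f : C^∞⟮I, M; ℝ⟯) τ, Λ (f • τ) = f m * Λ τ) :
    ∃ x : V.Tot, x.proj = m ∧ ∀ τ, linFun τ x = Λ τ := by
  obtain ⟨k, ρ, g, s, hρ, hg⟩ := V.exists_dual_frames m
  refine ⟨⟨m, ∑ i, Λ (g i) • s i m⟩, rfl, fun τ => ?_⟩
  let h : Fin k → C^∞⟮I, M; ℝ⟯ := fun i =>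
    ⟨fun m => linFun τ (pt (s i) m), (linFun_contMDiff τ).comp (contMDiff_pt (s i))⟩
  -- The functional is determined by its values on the `g i`, since `ρ² τ = ∑ τ(sᵢ) gᵢ` and `ρ m =
  -- 1`.
  have h1 : (ρ * ρ) • τ = ∑ i, h i • g i := by
    ext m' : 1
    rw [sec_sum_apply]
    ext x
    have h2 := congrArg (τ m') (hg m' x)
    rw [map_smul, map_sum] at h2
    rw [sum_apply]
    refine h2.trans (Finset.sum_congr rfl fun i _ => ?_)
    rw [map_smul, smul_eq_mul, mul_comm]
    rfl
  have h2 := congrArg Λ h1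
  rw [hΛ, map_sum] at h2
  simp only [hΛ] at h2
  change ρ m * ρ m * Λ τ = _ at h2
  rw [hρ, one_mul, one_mul] at h2
  rw [h2]
  exact (linFun_sum_smul τ _ _).trans (Finset.sum_congr rfl fun i _ => mul_comm _ _)

end SmoothVB

/-! ### Isotropic linear sections as skew doubly linear functions -/

namespace InvolutiveDVB
variable {n : ℕ} {M : Type u} [TopologicalSpace M] [ChartedSpace (EuclideanSpace ℝ (Fin n)) M]
  {Q : SmoothVB (𝓡 n) M} (D : InvolutiveDVB Q)

theorem inv_add₁ (d d' : D.Tot) (h : π₁ d = π₁ d') :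
    D.inv (add₁ d d') = add₂ (D.inv d) (D.inv d') :=
  D.ident_inj ((D.inv₁₂.map_add d d' h).trans (DoubleVectorBundle.ident_add₂ _ _).symm)

theorem inv_smul₁ (t : ℝ) (d : D.Tot) : D.inv (smul₁ t d) = smul₂ t (D.inv d) :=
  D.ident_inj ((D.inv₁₂.map_smul t d).trans (DoubleVectorBundle.ident_smul₂ _ _).symm)

theorem inv_add₂ (d d' : D.Tot) (h : π₂ d = π₂ d') :
    D.inv (add₂ d d') = add₁ (D.inv d) (D.inv d') := by
  have h1 := D.inv₂₁.map_add (D.ident d) (D.ident d') h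
  rw [D.ident.symm_apply_apply, D.ident.symm_apply_apply] at h1
  exact h1

theorem inv_smul₂ (t : ℝ) (d : D.Tot) : D.inv (smul₂ t d) = smul₁ t (D.inv d) := by
  have h1 := D.inv₂₁.map_smul t (D.ident d)
  rw [D.ident.symm_apply_apply] at h1
  exact h1

theorem contMDiff_inv : ContMDiff D.model D.model ∞ D.inv := by
  have h := D.ident.symm.contMDiff.comp D.inv₁₂.smooth
  have h1 : D.inv = D.ident.symm ∘ fun d => D.ident (D.inv d) := by
    funext d
    exact (D.ident.symm_apply_apply _).symm
  rw [h1]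
  exact h

theorem inv_of_isCore {m : M} {c : D.Tot} (hc : D.IsCore m c) : D.inv c = smul₁ (-1) c := by
  obtain ⟨q, x⟩ := c
  obtain ⟨h1, h2⟩ := hc
  obtain rfl : q = tzero Q m := h1
  refine (D.inv_core m ⟨x, h2⟩).trans ?_
  exact congrArg (fun x => (⟨tzero Q m, x⟩ : D.Tot)) (neg_one_smul ℝ x).symm

/-- The skew-symmetrisation of a function with respect to the involution. -/
def skewPart (f : D.Tot → ℝ) (d : D.Tot) : ℝ := (1 / 2 : ℝ) * (f d - f (D.inv d))

variable {D} in
theorem isBilinear_skewPart {f : D.Tot → ℝ} (hf : D.IsBilinear f) :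
    D.IsBilinear (D.skewPart f) where
  smooth := contMDiff_const.mul (hf.smooth.sub (hf.smooth.comp D.contMDiff_inv))
  add₁ d d' h := by
    simp only [skewPart]
    rw [hf.add₁ d d' h, D.inv_add₁ d d' h, hf.add₂ _ _ (by rw [D.π₂_inv, D.π₂_inv, h])]
    ring
  smul₁ t d := by
    simp only [skewPart]
    rw [hf.smul₁, D.inv_smul₁, hf.smul₂]
    ring
  add₂ d d' h := by
    simp only [skewPart]
    rw [hf.add₂ d d' h, D.inv_add₂ d d' h, hf.add₁ _ _ (by rw [D.π₁_inv, D.π₁_inv, h])]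
    ring
  smul₂ t d := by
    simp only [skewPart]
    rw [hf.smul₂, D.inv_smul₂, hf.smul₁]
    ring

variable {D} in
theorem isBilinear_linFun {χ : D.dualE.Sec} (h : χ ∈ D.isotropicSections) :
    D.IsBilinear (linFun χ) where
  smooth := linFun_contMDiff χ
  add₁ d d' h := linFun_tadd χ d d' h
  smul₁ t d := linFun_tsmul χ t d
  add₂ d d' hd := by
    have hp : (π₁ d).proj = (π₁ d').proj := by rw [D.square, D.square, hd]
    have h1 := (h.1.add (π₁ d) (π₁ d') hp).2 d d' rfl rfl hd
    rw [← D.π₁_add₂ d d' hd] at h1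
    exact (ev_pt χ _).symm.trans (h1.trans (congrArg₂ (· + ·) (ev_pt χ d) (ev_pt χ d')))
  smul₂ t d := by
    have h1 := (h.1.smul t (π₁ d)).2 d rfl
    rw [← D.π₁_smul₂ t d] at h1
    exact (ev_pt χ _).symm.trans (h1.trans (congrArg (t * ·) (ev_pt χ d)))

variable {D} in
theorem linFun_inv {χ : D.dualE.Sec} (h : χ ∈ D.isotropicSections) (d : D.Tot) :
    linFun χ (D.inv d) = - linFun χ d := by
  have hp : (π₁ d).proj = (π₂ d).proj := D.square d
  have h1 := h.2 (π₁ d) (π₂ d) hp d rfl rfl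
  rw [← D.π₁_inv d] at h1
  have h2 : linFun χ d + linFun χ (D.inv d) = 0 :=
    (congrArg₂ (· + ·) (ev_pt χ d) (ev_pt χ (D.inv d))).symm.trans h1
  linarith

variable {D} in
-- Converse of `isBilinear_linFun` and `linFun_inv`: it allows elements of `𝒞(𝔼)` to be constructed
-- as functions on `D`.
theorem mem_isotropicSections {χ : D.dualE.Sec} (hb : D.IsBilinear (linFun χ))
    (hi : ∀ d, linFun χ (D.inv d) = - linFun χ d) : χ ∈ D.isotropicSections := by
  have hev : ∀ (q : Q.Tot) (d : D.Tot), π₁ d = q → ev (pt χ q) d = linFun χ d := by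
    rintro q d rfl
    exact ev_pt χ d
  -- The projection to the dual core may be read off at the zero of `Q_m`: a doubly linear function
  -- vanishes on `0_a`, so its value on `0_a +₂ c` is its value on `c`.
  refine ⟨⟨⟨fun m => D.dualProj (pt χ (tzero Q m)), fun a => ?_⟩,
    fun a a' h => ⟨rfl, fun d₁ d₂ h₁ h₂ h₃ => ?_⟩, fun t a => ⟨rfl, fun d h => ?_⟩⟩,
    fun q q' h d h₁ h₂ => ?_⟩
  · ext c
    have key : ∀ (b : Q.Tot) (c : D.coreFib b.proj),
        ev (pt χ b) (D.addCore b c) = linFun χ (D.coreIncl c) := fun b c => by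
      rw [hev b _ (D.π₁_addCore b c), DoubleVectorBundle.addCore,
        hb.add₂ _ _ (D.π₂_zero_core b c), hb.zero₁, zero_add]
    exact (key a c).trans (key (tzero Q a.proj) c).symm
  · have h₁' : π₁ d₁ = a := h₁
    have h₂' : π₁ d₂ = a' := h₂
    have h4 : π₁ (add₂ d₁ d₂) = tadd a a' := by rw [D.π₁_add₂ _ _ h₃, h₁', h₂']
    rw [hev _ _ h4, hev _ _ h₁', hev _ _ h₂', hb.add₂ _ _ h₃]
  · have h' : π₁ d = a := h
    have h4 : π₁ (smul₂ t d) = tsmul t a := by rw [D.π₁_smul₂, h']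
    rw [hev _ _ h4, hev _ _ h', hb.smul₂]
  · have h₁' : π₁ d = q := h₁
    have h₂' : π₂ d = q' := h₂
    have h5 : π₁ (D.inv d) = q' := by rw [D.π₁_inv, h₂']
    rw [hev _ _ h₁', hev _ _ h5, hi, add_neg_cancel]

/-- The linear isotropic section defined by a skew-symmetric bilinear function. -/
def ofBilinear {f : D.Tot → ℝ} (hf : D.IsBilinear f) (hi : ∀ d, f (D.inv d) = - f d) :
    D.isotropicSections :=
  ⟨hf.sec, mem_isotropicSections hf hi⟩

theorem skewPart_inv (f : D.Tot → ℝ) (d : D.Tot) :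
    D.skewPart f (D.inv d) = - D.skewPart f d := by
  simp only [skewPart, D.inv_inv]
  ring

/-- The involution is `-1` on the core, so the two halves of the antisymmetrisation coincide there.
-/
theorem skewPart_core {f : D.Tot → ℝ} (hf : D.IsBilinear f) {m : M} {c : D.Tot}
    (hc : D.IsCore m c) : D.skewPart f c = f c := by
  rw [skewPart, D.inv_of_isCore hc, hf.smul₁]
  ring

/-- The linear isotropic section defined by a section of the dual of `D → Q`. -/
def isotropicPart [IsManifold (𝓡 n) ∞ M] (s : D.dualE.Sec) : D.isotropicSections :=
  D.ofBilinear (isBilinear_skewPart (DoubleVectorBundle.isBilinear_bilin s)) (D.skewPart_inv _)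

theorem linFun_isotropicPart [IsManifold (𝓡 n) ∞ M] (s : D.dualE.Sec) (d : D.Tot) :
    linFun (D.isotropicPart s).1 d = D.skewPart (D.bilin s) d := rfl

theorem linFun_smul (f : C^∞⟮𝓡 n, M; ℝ⟯) (χ : D.isotropicSections) (d : D.Tot) :
    linFun (f • χ).1 d = f (π₁ d).proj * linFun χ.1 d := rfl

theorem linFun_wedge (τ₁ τ₂ : Q.dual.Sec) (d : D.Tot) :
    linFun (D.wedge τ₁ τ₂).1 d = wedgeForm τ₁ τ₂ (π₁ d) (π₂ d) := rfl

theorem linFun_sum {k : ℕ} (χ : Fin k → D.isotropicSections) (d : D.Tot) :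
    linFun (∑ i, χ i).1 d = ∑ i, linFun (χ i).1 d := by
  let φ : D.isotropicSections →+ ℝ := ⟨⟨fun χ => linFun χ.1 d, rfl⟩, fun _ _ => rfl⟩
  exact map_sum φ χ Finset.univ

theorem isotropicSections_ext {χ χ' : D.isotropicSections}
    (h : ∀ d, linFun χ.1 d = linFun χ'.1 d) : χ = χ' := by
  refine Subtype.ext ?_
  ext q : 1
  ext x
  exact h ⟨q, x⟩

/-- A point of `D` is determined by its projections and by the values on it of the linear isotropic
sections. -/
theorem eq_of_linFun_isotropic_eq [IsManifold (𝓡 n) ∞ M] [T2Space M] {d d' : D.Tot}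
    (h₁ : π₁ d = π₁ d') (h₂ : π₂ d = π₂ d')
    (h : ∀ χ : D.isotropicSections, linFun χ.1 d = linFun χ.1 d') : d = d' := by
  have := t2Space_tot Q
  set m := (π₁ d).proj with hm
  -- The difference over the first side has second projection zero; subtracting `0` over `π₁ d` in
  -- the second structure moves it into the core, where it is called `c`.
  let e : D.Tot := add₁ d (smul₁ (-1) d')
  have hee : add₁ d' e = d := tadd_tadd_neg h₁
  have he₂ : π₂ e = tzero Q m := by
    rw [D.π₂_add₁ _ _ (by rw [D.π₁_smul₁, h₁]), D.π₂_smul₁, ← h₂, tadd_tsmul_neg_one, hm,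
      D.square]
  have he₁ : π₁ e = π₁ d := D.π₁_add₁ _ _
  have hz₂ : π₂ (smul₂ (-1) (D.zero₁ (π₁ d))) = tzero Q m := by
    rw [D.π₂_smul₂, D.π₂_zero₁]
  let c : D.Tot := add₂ e (smul₂ (-1) (D.zero₁ (π₁ d)))
  have hc : D.IsCore m c := by
    refine ⟨?_, ?_⟩
    · rw [D.π₁_add₂ _ _ (he₂.trans hz₂.symm), he₁, D.π₁_smul₂, D.π₁_zero₁, tadd_tsmul_neg_one]
    · rw [D.π₂_add₂, he₂]
  have hce : add₂ (D.zero₁ (π₁ d)) c = e := by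
    apply D.ident_inj
    rw [DoubleVectorBundle.ident_add₂, DoubleVectorBundle.ident_add₂,
      DoubleVectorBundle.ident_smul₂]
    exact tadd_tadd_neg (he₂.trans (D.π₂_zero₁ _).symm)
  have hχ : ∀ χ : D.isotropicSections, linFun χ.1 c = 0 := fun χ => by
    have hb := isBilinear_linFun χ.2
    rw [hb.add₂ _ _ (he₂.trans hz₂.symm), hb.add₁ _ _ (by rw [D.π₁_smul₁, h₁]), hb.smul₁, hb.smul₂,
      hb.zero₁, h]
    ring
  -- On the core `isotropicPart g` has the same values as `g`, and the sections `g` of the dual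
  -- separate points.
  have hc0 : c = D.zero₁ (tzero Q m) := by
    refine eq_of_linFun_eq (V := D.over₁) hc.1 fun g => ?_
    have h1 := hχ (D.isotropicPart g)
    rw [linFun_isotropicPart, D.skewPart_core (DoubleVectorBundle.isBilinear_bilin g) hc,
      DoubleVectorBundle.bilin_core g hc] at h1
    exact h1.trans (linFun_tzero g _).symm
  rw [hc0, D.zero₁_tzero, D.add₂_zero₂ (D.π₂_zero₁ _)] at hce
  rw [← hee, ← hce, D.add₁_zero₁ h₁.symm]

/-- Half the difference of the expansions at `d` and at `D.inv d`. The involution exchanges the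
projections, so the product terms combine into wedge forms. -/
theorem skew_sum {k : ℕ} {r c : ℝ} {a b b' s t s' t' : Fin k → ℝ}
    (h : r * r * c = ∑ i, (a i * b i + s i * t i))
    (h' : r * r * -c = ∑ i, (a i * b' i + s' i * t' i)) :
    r * (r * c) = ∑ i, (a i * ((1 / 2 : ℝ) * (b i - b' i)) +
      (1 / 2 : ℝ) * (s i * t i - t' i * s' i)) := by
  have e : r * (r * c) = (1 / 2 : ℝ) * (r * r * c - r * r * -c) := by ring
  rw [e, h, h', ← Finset.sum_sub_distrib, Finset.mul_sum]
  exact Finset.sum_congr rfl fun i _ => by ring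

theorem eq_sum_of_semilinear {R N : Type*} [CommRing R] [AddCommGroup N] [Module R N] {ε : R → ℝ}
    {Λ : N →+ ℝ} (hΛ : ∀ f χ, Λ (f • χ) = ε f * Λ χ) {k : ℕ} {ρ : R} {h : Fin k → R}
    {χ : N} {ξ w : Fin k → N} (hχ : ρ • ρ • χ = ∑ i, (h i • ξ i + w i)) (hρ : ε ρ = 1)
    (hw : ∀ i, Λ (w i) = 0) : Λ χ = ∑ i, ε (h i) * Λ (ξ i) := by
  have h2 := congrArg Λ hχ
  rw [hΛ, hΛ, map_sum, hρ, one_mul, one_mul] at h2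
  rw [h2]
  exact Finset.sum_congr rfl fun i _ => by rw [map_add, hΛ, hw, add_zero]

/-- Near a point of `M`, the linear isotropic sections are generated by finitely many of them and by
the wedge products. -/
theorem exists_isotropic_generators [IsManifold (𝓡 n) ∞ M] [T2Space M] (m : M) :
    ∃ (k : ℕ) (ρ : C^∞⟮𝓡 n, M; ℝ⟯) (ξ : Fin k → D.isotropicSections)
      (v : Fin k → D.over₁.Fib (tzero Q m)), ρ m = 1 ∧ ∀ χ : D.isotropicSections,
        ∃ (h : Fin k → C^∞⟮𝓡 n, M; ℝ⟯) (σ τ : Fin k → Q.dual.Sec),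
          (∀ i, h i m = linFun χ.1 ⟨tzero Q m, v i⟩) ∧
          ρ • ρ • χ = ∑ i, (h i • ξ i + D.wedge (σ i) (τ i)) := by
  have H := D.exists_generators m
  obtain ⟨k, ρ, g, v, hρ, hg⟩ := H
  refine ⟨k, ρ, fun i => D.isotropicPart (g i), v, hρ, fun χ => ?_⟩
  have H := hg _ (isBilinear_linFun χ.2)
  obtain ⟨h, σ, hh, hσ⟩ := H
  refine ⟨h, σ, fun i => D.onZero₂ (g i), hh, D.isotropicSections_ext fun d => ?_⟩
  have hp : (π₂ d).proj = (π₁ d).proj := (D.square d).symm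
  have e2 := hσ (D.inv d)
  simp only [D.π₁_inv, D.π₂_inv, hp] at e2
  have e3 := skew_sum (hσ d)
    ((congrArg (ρ (π₁ d).proj * ρ (π₁ d).proj * ·) (linFun_inv χ.2 d).symm).trans e2)
  have s1 := (D.linFun_smul ρ (ρ • χ) d).trans (congrArg (ρ (π₁ d).proj * ·) (D.linFun_smul ρ χ d))
  have s2 := D.linFun_sum (fun i => h i • D.isotropicPart (g i) + D.wedge (σ i) (D.onZero₂ (g i))) d
  exact s1.trans (e3.trans ((Finset.sum_congr rfl fun i _ => rfl).trans s2.symm))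

/-- A linear form on the linear isotropic sections that is `C^∞(M)`-linear with respect to
evaluation at a point, and vanishes on wedge products, is the evaluation on a core element. -/
theorem exists_core_eq_linFun [IsManifold (𝓡 n) ∞ M] [T2Space M] (m : M)
    (Λ : D.isotropicSections →+ ℝ) (hΛ : ∀ (f : C^∞⟮𝓡 n, M; ℝ⟯) χ, Λ (f • χ) = f m * Λ χ)
    (hw : ∀ τ₁ τ₂, Λ (D.wedge τ₁ τ₂) = 0) :
    ∃ c : D.Tot, D.IsCore m c ∧ ∀ χ : D.isotropicSections, linFun χ.1 c = Λ χ := by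
  have H := D.exists_isotropic_generators m
  obtain ⟨k, ρ, ξ, v, hρ, hg⟩ := H
  have H : ∃ x : D.Tot, π₁ x = tzero Q m ∧
      ∀ χ : D.isotropicSections, linFun χ.1 x = Λ χ := by
    -- Since `h i m = χ(vᵢ)`, the expansion reads `Λ χ = ∑ χ(vᵢ) Λ(ξᵢ)`, which is `χ` evaluated at
    -- this vector.
    refine ⟨⟨tzero Q m, ∑ i, Λ (ξ i) • v i⟩, rfl, fun χ => ?_⟩
    have H := hg χ
    obtain ⟨h, σ, τ, hh, hsum⟩ := H
    have h2 := eq_sum_of_semilinear (ε := fun f : C^∞⟮𝓡 n, M; ℝ⟯ => f m) hΛ hsum hρ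
      (fun i => hw (σ i) (τ i))
    refine (linFun_sum_smul χ.1 _ _).trans ((Finset.sum_congr rfl fun i _ => ?_).trans h2.symm)
    exact (mul_comm _ _).trans (congrArg (· * Λ (ξ i)) (hh i).symm)
  obtain ⟨x, hx₁, hxΛ⟩ := H
  have hx₂ : (π₂ x).proj = m := (D.square x).symm.trans (congrArg TotalSpace.proj hx₁)
  have hz₁ : π₁ x = π₁ (smul₁ (-1) (D.zero₂ (π₂ x))) := by
    rw [D.π₁_smul₁, D.π₁_zero₂, hx₂, hx₁]
  -- The second projection of `x` need not vanish. Subtracting the zero over `π₂ x` moves `x` into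
  -- the core without changing the values of doubly linear functions.
  refine ⟨add₁ x (smul₁ (-1) (D.zero₂ (π₂ x))), ⟨(D.π₁_add₁ _ _).trans hx₁, ?_⟩, fun χ => ?_⟩
  · rw [D.π₂_add₁ _ _ hz₁, D.π₂_smul₁, D.π₂_zero₂, tadd_tsmul_neg_one, hx₂]
  · have hb := isBilinear_linFun χ.2
    have e1 := hb.smul₁ (-1) (D.zero₂ (π₂ x))
    rw [hb.zero₂, mul_zero] at e1
    exact (hb.add₁ _ _ hz₁).trans (((congrArg (linFun χ.1 x + ·) e1).trans (add_zero _)).trans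
      (hxΛ χ))

/-- A linear form on the linear isotropic sections that is `C^∞(M)`-linear with respect to
evaluation at a point, and has the right values on wedge products, is the evaluation on a point with
prescribed projections. -/
theorem exists_point_eq_linFun [IsManifold (𝓡 n) ∞ M] [T2Space M] {m : M} {a b : Q.Tot}
    (ha : a.proj = m) (hb : b.proj = m)
    (Λ : D.isotropicSections →+ ℝ) (hΛ : ∀ (f : C^∞⟮𝓡 n, M; ℝ⟯) χ, Λ (f • χ) = f m * Λ χ)
    (hw : ∀ τ₁ τ₂, Λ (D.wedge τ₁ τ₂) = wedgeForm τ₁ τ₂ a b) :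
    ∃ d : D.Tot, π₁ d = a ∧ π₂ d = b ∧ ∀ χ : D.isotropicSections, linFun χ.1 d = Λ χ := by
  have H := D.exists_over a b (ha.trans hb.symm)
  obtain ⟨d, hd₁, hd₂⟩ := H
  have H : ∃ φ : D.isotropicSections →+ ℝ, ∀ χ, φ χ = Λ χ - linFun χ.1 d :=
    ⟨Λ - ⟨⟨fun χ => linFun χ.1 d, rfl⟩, fun _ _ => rfl⟩, fun _ => rfl⟩
  obtain ⟨φ, hφ⟩ := H
  -- Wedges depend on the projections only, so the defect `φ` vanishes on them and is represented by
  -- a core element, by which `d` is then translated.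
  have H := D.exists_core_eq_linFun m φ
    (fun f χ => by
      have e1 : linFun (f • χ).1 d = f m * linFun χ.1 d := (D.linFun_smul f χ d).trans
        (congrArg (fun q : Q.Tot => f q.proj * linFun χ.1 d) hd₁ |>.trans
          (congrArg (fun q => f q * linFun χ.1 d) ha))
      refine (hφ (f • χ)).trans ((congrArg₂ (· - ·) (hΛ f χ) e1).trans ?_)
      exact (mul_sub _ _ _).symm.trans (congrArg (f m * ·) (hφ χ).symm))
    (fun τ₁ τ₂ => by
      have e1 := (D.linFun_wedge τ₁ τ₂ d).trans (congrArg₂ (wedgeForm τ₁ τ₂) hd₁ hd₂)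
      exact (hφ _).trans ((congrArg₂ (· - ·) (hw τ₁ τ₂) e1).trans (sub_self _)))
  obtain ⟨c, hc, hcΛ⟩ := H
  have hz : π₂ (D.zero₁ a) = π₂ c := by rw [D.π₂_zero₁, hc.2, ha]
  have hc₁ : π₁ (add₂ (D.zero₁ a) c) = a := by
    rw [D.π₁_add₂ _ _ hz, hc.1, D.π₁_zero₁, ← ha, tadd_tzero]
  have hc₂ : π₂ (add₂ (D.zero₁ a) c) = tzero Q m := by rw [D.π₂_add₂, D.π₂_zero₁, ha]
  refine ⟨add₁ d (add₂ (D.zero₁ a) c), (D.π₁_add₁ _ _).trans hd₁, ?_, fun χ => ?_⟩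
  · rw [D.π₂_add₁ _ _ (hd₁.trans hc₁.symm), hc₂, hd₂, ← hb, tadd_tzero]
  · have hχ := isBilinear_linFun χ.2
    have e1 : linFun χ.1 (add₂ (D.zero₁ a) c) = linFun χ.1 c :=
      (hχ.add₂ _ _ hz).trans ((congrArg (· + linFun χ.1 c) (hχ.zero₁ a)).trans (zero_add _))
    have e2 := (hχ.add₁ _ _ (hd₁.trans hc₁.symm)).trans
      (congrArg (linFun χ.1 d + ·) (e1.trans ((hcΛ χ).trans (hφ χ))))
    exact e2.trans (add_sub_cancel _ _)

end InvolutiveDVB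

/-! ### Linear functions pulled back through the second projection -/

namespace DoubleVectorBundle
variable {n : ℕ} {M : Type u} [TopologicalSpace M] [ChartedSpace (EuclideanSpace ℝ (Fin n)) M]
  {A B : SmoothVB (𝓡 n) M} (D : DoubleVectorBundle A B)

/-- The pullback to `D` of a linear function on `B`, as a section of the dual of `D → A`. -/
def pullπ₂ (τ : B.dual.Sec) : D.over₁.dual.Sec :=
  secOfFun (fun d : D.Tot => linFun τ (π₂ d)) ((linFun_contMDiff τ).comp D.contMDiff_π₂)
    (fun a u v => by
      have h := D.π₂_add₁ (⟨a, u⟩ : D.Tot) ⟨a, v⟩ rfl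
      rw [add₁, tadd_mk] at h
      rw [h]
      exact linFun_tadd τ _ _ ((D.square (⟨a, u⟩ : D.Tot)).symm.trans (D.square (⟨a, v⟩ : D.Tot))))
    (fun a t u => by
      have h : π₂ (⟨a, t • u⟩ : D.Tot) = tsmul t (π₂ (⟨a, u⟩ : D.Tot)) :=
        D.proj₂.map_smul t (⟨a, u⟩ : D.Tot)
      rw [h]
      exact linFun_tsmul τ t _)

theorem linFun_pullπ₂ (τ : B.dual.Sec) (d : D.Tot) : linFun (D.pullπ₂ τ) d = linFun τ (π₂ d) := rfl

end DoubleVectorBundle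

/-! ### From a morphism to its pair of pullbacks -/

section
variable {n₁ n₂ : ℕ}
  {M₁ : Type u} [TopologicalSpace M₁] [ChartedSpace (EuclideanSpace ℝ (Fin n₁)) M₁]
  {M₂ : Type v} [TopologicalSpace M₂] [ChartedSpace (EuclideanSpace ℝ (Fin n₂)) M₂]

namespace DVBHom
variable {A₁ B₁ : SmoothVB (𝓡 n₁) M₁} {A₂ B₂ : SmoothVB (𝓡 n₂) M₂}
  {D₁ : DoubleVectorBundle A₁ B₁} {D₂ : DoubleVectorBundle A₂ B₂} (Ω : DVBHom D₁ D₂)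

theorem π₁_toFun (d : D₁.Tot) : π₁ (Ω.toFun d) = Ω.sideA (π₁ d) := Ω.over₁.proj d

theorem π₂_toFun (d : D₁.Tot) : π₂ (Ω.toFun d) = Ω.sideB (π₂ d) := by
  have h := Ω.over₂.proj (D₁.ident d)
  rw [D₁.ident.symm_apply_apply] at h
  exact h

theorem toFun_add₁ (d d' : D₁.Tot) (h : π₁ d = π₁ d') :
    Ω.toFun (add₁ d d') = add₁ (Ω.toFun d) (Ω.toFun d') := Ω.over₁.map_add d d' h

theorem toFun_smul₁ (t : ℝ) (d : D₁.Tot) : Ω.toFun (smul₁ t d) = smul₁ t (Ω.toFun d) :=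
  Ω.over₁.map_smul t d

theorem ident_toFun (d : D₁.Tot) :
    D₂.ident (Ω.toFun (D₁.ident.symm (D₁.ident d))) = D₂.ident (Ω.toFun d) :=
  congrArg (fun e => D₂.ident (Ω.toFun e)) (D₁.ident.symm_apply_apply d)

theorem toFun_add₂ (d d' : D₁.Tot) (h : π₂ d = π₂ d') :
    Ω.toFun (add₂ d d') = add₂ (Ω.toFun d) (Ω.toFun d') :=
  D₂.ident_inj ((Ω.over₂.map_add (D₁.ident d) (D₁.ident d') h).trans
    ((congrArg₂ tadd (Ω.ident_toFun d) (Ω.ident_toFun d')).trans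
      (DoubleVectorBundle.ident_add₂ _ _).symm))

theorem toFun_smul₂ (t : ℝ) (d : D₁.Tot) : Ω.toFun (smul₂ t d) = smul₂ t (Ω.toFun d) :=
  D₂.ident_inj ((Ω.over₂.map_smul t (D₁.ident d)).trans
    ((congrArg (tsmul t) (Ω.ident_toFun d)).trans (DoubleVectorBundle.ident_smul₂ _ _).symm))

theorem isBilinear_comp {f : D₂.Tot → ℝ} (hf : D₂.IsBilinear f) :
    D₁.IsBilinear (fun d => f (Ω.toFun d)) where
  smooth := hf.smooth.comp Ω.over₁.smooth
  add₁ d d' h := (congrArg f (Ω.toFun_add₁ d d' h)).trans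
    (hf.add₁ _ _ (by rw [Ω.π₁_toFun, Ω.π₁_toFun, h]))
  smul₁ t d := (congrArg f (Ω.toFun_smul₁ t d)).trans (hf.smul₁ _ _)
  add₂ d d' h := (congrArg f (Ω.toFun_add₂ d d' h)).trans
    (hf.add₂ _ _ (by rw [Ω.π₂_toFun, Ω.π₂_toFun, h]))
  smul₂ t d := (congrArg f (Ω.toFun_smul₂ t d)).trans (hf.smul₂ _ _)

end DVBHom

variable {Q₁ : SmoothVB (𝓡 n₁) M₁} {Q₂ : SmoothVB (𝓡 n₂) M₂}
  {D₁ : InvolutiveDVB Q₁} {D₂ : InvolutiveDVB Q₂}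

namespace IDVBHom
variable (Ω : IDVBHom D₁ D₂)

/-- The involution exchanges the projections and commutes with `Ω`; any point over `q` shows the
equality, here a zero. -/
theorem sideB_eq_sideA : Ω.sideB = Ω.sideA := by
  funext q
  have h := Ω.π₁_toFun (D₁.inv (D₁.zero₂ q))
  rw [Ω.comm_inv, D₂.π₁_inv, D₁.π₁_inv, Ω.π₂_toFun, D₁.π₂_zero₂] at h
  exact h

/-- The base map, as a smooth map. -/
def baseMap : C^∞⟮𝓡 n₁, M₁; 𝓡 n₂, M₂⟯ := ⟨Ω.base, Ω.overA.smooth_base⟩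

/-- The pullback of linear isotropic sections. -/
def pullC : D₂.isotropicSections →ₛₗ[pullbackFun Ω.baseMap] D₁.isotropicSections where
  toFun χ := D₁.ofBilinear (Ω.isBilinear_comp (InvolutiveDVB.isBilinear_linFun χ.2)) fun d =>
    (congrArg (linFun χ.1) (Ω.comm_inv d)).trans (InvolutiveDVB.linFun_inv χ.2 _)
  map_add' _ _ := D₁.isotropicSections_ext fun _ => rfl
  map_smul' f χ := D₁.isotropicSections_ext fun d => by
    have h : (π₁ (Ω.toFun d)).proj = Ω.base (π₁ d).proj :=
      (congrArg TotalSpace.proj (Ω.π₁_toFun d)).trans (Ω.overA.proj _)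
    exact (D₂.linFun_smul f χ (Ω.toFun d)).trans
      (congrArg (fun m => f m * linFun χ.1 (Ω.toFun d)) h)

/-- The pullback of linear functions on the side. -/
def pullQ : Q₂.dual.Sec →ₛₗ[pullbackFun Ω.baseMap] Q₁.dual.Sec where
  toFun τ := secOfFun (fun q => linFun τ (Ω.sideA q)) ((linFun_contMDiff τ).comp Ω.overA.smooth)
    (fun m u v => by
      have h := Ω.overA.map_add ⟨m, u⟩ ⟨m, v⟩ rfl
      rw [tadd_mk] at h
      rw [h]
      exact linFun_tadd τ _ _ ((Ω.overA.proj ⟨m, u⟩).trans (Ω.overA.proj ⟨m, v⟩).symm))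
    (fun m t u => (congrArg (linFun τ) (Ω.overA.map_smul t ⟨m, u⟩)).trans (linFun_tsmul τ t _))
  map_add' _ _ := by
    ext m : 1
    ext x
    rfl
  map_smul' f τ := by
    ext m : 1
    ext x
    exact congrArg (fun m => f m * linFun τ (Ω.sideA ⟨_, x⟩)) (Ω.overA.proj ⟨m, x⟩)

/-- The pair of module morphisms that is induced by a morphism. -/
def toPair : ModuleMorphismPair D₁ D₂ where
  base := Ω.baseMap
  mapC := Ω.pullC
  mapQ := Ω.pullQ
  map_wedge τ₁ τ₂ := D₁.isotropicSections_ext fun d =>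
    congrArg₂ (InvolutiveDVB.wedgeForm τ₁ τ₂) (Ω.π₁_toFun d)
      ((Ω.π₂_toFun d).trans (congrFun Ω.sideB_eq_sideA (π₂ d)))

theorem induces_toPair : Ω.Induces Ω.toPair := ⟨fun _ => rfl, fun _ _ => rfl, fun _ _ => rfl⟩

variable {Ω} in
theorem Induces.unique {T T' : ModuleMorphismPair D₁ D₂} (h : Ω.Induces T) (h' : Ω.Induces T') :
    T = T' := by
  obtain ⟨b, c, q, w⟩ := T
  obtain ⟨b', c', q', w'⟩ := T'
  obtain rfl : b = b' := by
    ext m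
    exact (h.base m).trans (h'.base m).symm
  obtain rfl : c = c' := by
    refine LinearMap.ext fun χ => D₁.isotropicSections_ext fun d => ?_
    exact (h.mapC χ d).trans (h'.mapC χ d).symm
  obtain rfl : q = q' := by
    refine LinearMap.ext fun τ => ?_
    ext m : 1
    ext x
    exact (h.mapQ τ ⟨m, x⟩).trans (h'.mapQ τ ⟨m, x⟩).symm
  rfl

theorem unique_of_induces [IsManifold (𝓡 n₂) ∞ M₂] [T2Space M₂] {Ω Ω' : IDVBHom D₁ D₂}
    {T : ModuleMorphismPair D₁ D₂} (h : Ω.Induces T) (h' : Ω'.Induces T) : Ω = Ω' := by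
  have hbase : Ω.base = Ω'.base := funext fun m => (h.base m).symm.trans (h'.base m)
  have hA : Ω.sideA = Ω'.sideA := by
    funext q
    refine eq_of_linFun_eq ?_ fun τ => (h.mapQ τ q).symm.trans (h'.mapQ τ q)
    rw [Ω.overA.proj, Ω'.overA.proj, hbase]
  have hB : Ω.sideB = Ω'.sideB := by rw [Ω.sideB_eq_sideA, Ω'.sideB_eq_sideA, hA]
  have hfun : Ω.toFun = Ω'.toFun := by
    funext d
    refine D₂.eq_of_linFun_isotropic_eq ?_ ?_ fun χ => (h.mapC χ d).symm.trans (h'.mapC χ d)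
    · rw [Ω.π₁_toFun, Ω'.π₁_toFun, hA]
    · rw [Ω.π₂_toFun, Ω'.π₂_toFun, hB]
  obtain ⟨⟨f, a, b, m, _, _, _, _⟩, _⟩ := Ω
  obtain ⟨⟨f', a', b', m', _, _, _, _⟩, _⟩ := Ω'
  obtain rfl : f = f' := hfun
  obtain rfl : a = a' := hA
  obtain rfl : b = b' := hB
  obtain rfl : m = m' := hbase
  rfl

end IDVBHom

/-! ### From a pair of module morphisms to the morphism -/

namespace ModuleMorphismPair
variable [IsManifold (𝓡 n₂) ∞ M₂] [T2Space M₂] (T : ModuleMorphismPair D₁ D₂)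

theorem exists_side (q : Q₁.Tot) : ∃ x : Q₂.Tot, x.proj = T.base q.proj ∧
    ∀ τ, linFun τ x = linFun (T.mapQ τ) q :=
  exists_eq_linFun (T.base q.proj)
    ⟨⟨fun τ => linFun (T.mapQ τ) q, by rw [map_zero]; rfl⟩, fun τ τ' => by
      change linFun (T.mapQ (τ + τ')) q = _
      rw [map_add]
      rfl⟩
    fun f τ => by
      change linFun (T.mapQ (f • τ)) q = _
      rw [map_smulₛₗ]
      rfl

/-- The side map of the morphism that is defined by a pair of module morphisms. -/
def side (q : Q₁.Tot) : Q₂.Tot := (T.exists_side q).choose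

theorem side_proj (q : Q₁.Tot) : (T.side q).proj = T.base q.proj := (T.exists_side q).choose_spec.1

theorem linFun_side (τ : Q₂.dual.Sec) (q : Q₁.Tot) : linFun τ (T.side q) = linFun (T.mapQ τ) q :=
  (T.exists_side q).choose_spec.2 τ

theorem isVBMorphism_side : IsVBMorphism Q₁ Q₂ T.side T.base where
  smooth q := by
    refine contMDiffAt_of_linFun ?_ q fun x hx => ?_
    · simp only [side_proj]
      exact T.base.contMDiff.comp (contMDiff_proj Q₁.Fib)
    · have h : (⟨_, x⟩ : Q₂.Tot) = tzero Q₂ _ := eq_of_linFun_eq rfl fun τ => by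
        rw [linFun_tzero]
        refine hx τ ?_
        simp only [linFun_side]
        exact linFun_contMDiff _
      exact TotalSpace.mk_inj.1 h
  smooth_base := T.base.contMDiff
  proj := T.side_proj
  map_add x y h := by
    have h' : (T.side x).proj = (T.side y).proj := by rw [side_proj, side_proj, h]
    refine eq_of_linFun_eq ?_ fun τ => ?_
    · rw [side_proj, tadd_proj, tadd_proj, side_proj]
    · rw [linFun_side, linFun_tadd _ _ _ h, linFun_tadd _ _ _ h', linFun_side, linFun_side]
  map_smul t x := by
    refine eq_of_linFun_eq ?_ fun τ => ?_
    · rw [side_proj, tsmul_proj, tsmul_proj, side_proj]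
    · rw [linFun_side, linFun_tsmul, linFun_tsmul, linFun_side]

/-- The only use of `T.map_wedge`: with it, `χ ↦ (ω^⋆ χ)(d)` has on wedges the values required for a
point over the two images under `T.side`. -/
theorem exists_total (d : D₁.Tot) : ∃ e : D₂.Tot, π₁ e = T.side (π₁ d) ∧ π₂ e = T.side (π₂ d) ∧
    ∀ χ : D₂.isotropicSections, linFun χ.1 e = linFun (T.mapC χ).1 d :=
  D₂.exists_point_eq_linFun (m := T.base (π₁ d).proj) (T.side_proj _)
    ((T.side_proj _).trans (congrArg T.base (D₁.square d).symm))
    ⟨⟨fun χ => linFun (T.mapC χ).1 d, (congrArg (fun χ : D₁.isotropicSections => linFun χ.1 d)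
        (map_zero T.mapC)).trans rfl⟩,
      fun χ χ' => congrArg (fun χ : D₁.isotropicSections => linFun χ.1 d) (map_add T.mapC χ χ')⟩
    (fun f χ => congrArg (fun χ : D₁.isotropicSections => linFun χ.1 d) (T.mapC.map_smulₛₗ f χ))
    (fun τ₁ τ₂ => (congrArg (fun χ : D₁.isotropicSections => linFun χ.1 d)
      (T.map_wedge τ₁ τ₂)).trans (by
        change InvolutiveDVB.wedgeForm _ _ _ _ = _
        simp only [InvolutiveDVB.wedgeForm, linFun_side]))

/-- The total map of the morphism that is defined by a pair of module morphisms. -/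
def total (d : D₁.Tot) : D₂.Tot := (T.exists_total d).choose

theorem π₁_total (d : D₁.Tot) : π₁ (T.total d) = T.side (π₁ d) := (T.exists_total d).choose_spec.1

theorem π₂_total (d : D₁.Tot) : π₂ (T.total d) = T.side (π₂ d) :=
  (T.exists_total d).choose_spec.2.1

theorem linFun_total (χ : D₂.isotropicSections) (d : D₁.Tot) :
    linFun χ.1 (T.total d) = linFun (T.mapC χ).1 d := (T.exists_total d).choose_spec.2.2 χ

theorem contMDiff_total : ContMDiff D₁.model D₂.model ∞ T.total := fun d => by
  refine contMDiffAt_of_linFun (V := D₂.over₁) ?_ d fun x hx => ?_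
  · have h : (fun d : D₁.Tot => (T.total d).proj) = fun d => T.side (π₁ d) := funext T.π₁_total
    rw [h]
    exact T.isVBMorphism_side.smooth.comp D₁.contMDiff_π₁
  -- Isotropic sections separate only points with equal projections, so functions pulled back
  -- through `π₂` are added to the test family. Both kinds have smooth composition with `T.total`.
  · have h : (⟨_, x⟩ : D₂.Tot) = D₂.zero₁ (T.total d).proj := by
      refine D₂.eq_of_linFun_isotropic_eq rfl ?_ fun χ => ?_
      · rw [D₂.π₂_zero₁]
        refine eq_of_linFun_eq (D₂.square _).symm fun τ => ?_
        rw [linFun_tzero, ← D₂.linFun_pullπ₂]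
        refine hx _ ?_
        have h : (fun d => linFun (D₂.pullπ₂ τ) (T.total d)) =
            fun d => linFun (T.mapQ τ) (π₂ d) := funext fun d =>
          (congrArg (linFun τ) (T.π₂_total d)).trans (T.linFun_side τ _)
        rw [h]
        exact (linFun_contMDiff _).comp D₁.contMDiff_π₂
      · refine (hx χ.1 ?_).trans (linFun_tzero χ.1 _).symm
        rw [funext (T.linFun_total χ)]
        exact linFun_contMDiff _
    exact TotalSpace.mk_inj.1 h

theorem total_add₁ (d d' : D₁.Tot) (h : π₁ d = π₁ d') :
    T.total (add₁ d d') = add₁ (T.total d) (T.total d') := by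
  have h₁ : π₁ (T.total d) = π₁ (T.total d') := by rw [π₁_total, π₁_total, h]
  refine D₂.eq_of_linFun_isotropic_eq ?_ ?_ fun χ => ?_
  · rw [π₁_total, D₁.π₁_add₁, D₂.π₁_add₁, π₁_total]
  · rw [π₂_total, D₁.π₂_add₁ _ _ h, D₂.π₂_add₁ _ _ h₁, π₂_total, π₂_total]
    exact T.isVBMorphism_side.map_add _ _ (by rw [← D₁.square, ← D₁.square, h])
  · exact (T.linFun_total χ _).trans (((InvolutiveDVB.isBilinear_linFun (T.mapC χ).2).add₁ d d' h).trans
      ((congrArg₂ (· + ·) (T.linFun_total χ d).symm (T.linFun_total χ d').symm).trans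
        ((InvolutiveDVB.isBilinear_linFun χ.2).add₁ _ _ h₁).symm))

theorem total_smul₁ (t : ℝ) (d : D₁.Tot) : T.total (smul₁ t d) = smul₁ t (T.total d) := by
  refine D₂.eq_of_linFun_isotropic_eq ?_ ?_ fun χ => ?_
  · rw [π₁_total, D₁.π₁_smul₁, D₂.π₁_smul₁, π₁_total]
  · rw [π₂_total, D₁.π₂_smul₁, D₂.π₂_smul₁, π₂_total]
    exact T.isVBMorphism_side.map_smul _ _
  · exact (T.linFun_total χ _).trans (((InvolutiveDVB.isBilinear_linFun (T.mapC χ).2).smul₁ t d).trans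
      ((congrArg (t * ·) (T.linFun_total χ d).symm).trans
        ((InvolutiveDVB.isBilinear_linFun χ.2).smul₁ t _).symm))

theorem total_inv (d : D₁.Tot) : T.total (D₁.inv d) = D₂.inv (T.total d) := by
  refine D₂.eq_of_linFun_isotropic_eq ?_ ?_ fun χ => ?_
  · rw [π₁_total, D₁.π₁_inv, D₂.π₁_inv, π₂_total]
  · rw [π₂_total, D₁.π₂_inv, D₂.π₂_inv, π₁_total]
  · exact (T.linFun_total χ _).trans ((InvolutiveDVB.linFun_inv (T.mapC χ).2 d).trans
      ((congrArg Neg.neg (T.linFun_total χ d).symm).trans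
        (InvolutiveDVB.linFun_inv χ.2 _).symm))

/-- Conjugation by the involutions turns the second structure into the first. -/
theorem total_add₂ (d d' : D₁.Tot) (h : π₂ d = π₂ d') :
    T.total (add₂ d d') = add₂ (T.total d) (T.total d') := by
  have h1 := T.total_add₁ (D₁.inv d) (D₁.inv d') (by rw [D₁.π₁_inv, D₁.π₁_inv, h])
  rw [← D₁.inv_add₂ d d' h, total_inv, total_inv, total_inv,
    ← D₂.inv_add₂ _ _ (by rw [π₂_total, π₂_total, h])] at h1
  exact (D₂.inv_inv _).symm.trans ((congrArg D₂.inv h1).trans (D₂.inv_inv _))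

theorem total_smul₂ (t : ℝ) (d : D₁.Tot) : T.total (smul₂ t d) = smul₂ t (T.total d) := by
  have h1 := T.total_smul₁ t (D₁.inv d)
  rw [← D₁.inv_smul₂, total_inv, total_inv, ← D₂.inv_smul₂] at h1
  exact (D₂.inv_inv _).symm.trans ((congrArg D₂.inv h1).trans (D₂.inv_inv _))

theorem ident_total_tadd (x y : D₁.over₂.Tot) (h : x.proj = y.proj) :
    D₂.ident (T.total (D₁.ident.symm (tadd x y))) =
      tadd (D₂.ident (T.total (D₁.ident.symm x))) (D₂.ident (T.total (D₁.ident.symm y))) := by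
  have hx := D₁.ident.apply_symm_apply x
  have hy := D₁.ident.apply_symm_apply y
  have h1 : T.total (add₂ (D₁.ident.symm x) (D₁.ident.symm y)) =
      add₂ (T.total (D₁.ident.symm x)) (T.total (D₁.ident.symm y)) :=
    T.total_add₂ _ _ ((congrArg TotalSpace.proj hx).trans
      (h.trans (congrArg TotalSpace.proj hy).symm))
  exact (congrArg (fun z => D₂.ident (T.total (D₁.ident.symm z)))
    (congrArg₂ tadd hx.symm hy.symm)).trans
      ((congrArg D₂.ident h1).trans (DoubleVectorBundle.ident_add₂ _ _))

theorem ident_total_tsmul (t : ℝ) (x : D₁.over₂.Tot) :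
    D₂.ident (T.total (D₁.ident.symm (tsmul t x))) =
      tsmul t (D₂.ident (T.total (D₁.ident.symm x))) := by
  have hx := D₁.ident.apply_symm_apply x
  exact (congrArg (fun z => D₂.ident (T.total (D₁.ident.symm z)))
    (congrArg (tsmul t) hx.symm)).trans
      ((congrArg D₂.ident (T.total_smul₂ t (D₁.ident.symm x))).trans
        (DoubleVectorBundle.ident_smul₂ _ _))

/-- The morphism of involutive double vector bundles that is defined by a pair of module
morphisms. -/
def toHom : IDVBHom D₁ D₂ where
  toFun := T.total
  sideA := T.side
  sideB := T.side
  base := T.base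
  over₁ :=
    { smooth := T.contMDiff_total
      smooth_base := T.isVBMorphism_side.smooth
      proj := T.π₁_total
      map_add := T.total_add₁
      map_smul := T.total_smul₁ }
  over₂ :=
    { smooth := D₂.ident.contMDiff.comp (T.contMDiff_total.comp D₁.ident.symm.contMDiff)
      smooth_base := T.isVBMorphism_side.smooth
      proj := fun x => (T.π₂_total (D₁.ident.symm x)).trans
        (congrArg (fun x => T.side x.proj) (D₁.ident.apply_symm_apply x))
      map_add := T.ident_total_tadd
      map_smul := T.ident_total_tsmul }
  overA := T.isVBMorphism_side
  overB := T.isVBMorphism_side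
  comm_inv := T.total_inv

theorem induces_toHom : T.toHom.Induces T :=
  ⟨fun _ => rfl, fun χ d => (T.linFun_total χ d).symm, fun τ q => (T.linFun_side τ q).symm⟩

end ModuleMorphismPair
end
end

/-- A morphism of involutive double vector bundles is equivalent to a pair of module morphisms over a
smooth map that is compatible with the wedge product: every morphism `Ω` induces exactly one such
pair, and every such pair is induced by exactly one `Ω`. -/
theorem theorem3p14 {n₁ n₂ : ℕ}
    {M₁ : Type u} [TopologicalSpace M₁] [ChartedSpace (EuclideanSpace ℝ (Fin n₁)) M₁]
    [IsManifold (𝓡 n₁) ∞ M₁] [T2Space M₁] [SecondCountableTopology M₁]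
    {M₂ : Type v} [TopologicalSpace M₂] [ChartedSpace (EuclideanSpace ℝ (Fin n₂)) M₂]
    [IsManifold (𝓡 n₂) ∞ M₂] [T2Space M₂] [SecondCountableTopology M₂]
    {Q₁ : SmoothVB (𝓡 n₁) M₁} {Q₂ : SmoothVB (𝓡 n₂) M₂}
    (D₁ : InvolutiveDVB Q₁) (D₂ : InvolutiveDVB Q₂) :
    (∀ Ω : IDVBHom D₁ D₂, ∃! T : ModuleMorphismPair D₁ D₂, Ω.Induces T) ∧
      (∀ T : ModuleMorphismPair D₁ D₂, ∃! Ω : IDVBHom D₁ D₂, Ω.Induces T) :=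
  ⟨fun Ω => ⟨Ω.toPair, Ω.induces_toPair, fun _ hT => hT.unique Ω.induces_toPair⟩,
    fun T => ⟨T.toHom, T.induces_toHom, fun _ hΩ =>
      IDVBHom.unique_of_induces hΩ T.induces_toHom⟩⟩
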